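/- Let $\hat\lambda,\hat\mu\in C^1((-\infty,0];\mathbb R)$ with $\hat\mu>0$ and $\hat\lambda+2\hat\mu>0$, and suppose that for some $Z_I<0$ they are constant on $(-\infty,Z_I]$, equal to $\hat\lambda_I,\hat\mu_I$ there. Put $H:=-Z_I$ and fix $\omega>0$. For $\xi\in\mathbb C$ consider on $Z\le 0$ the Rayleigh system for $\Phi=(\varphi_1,\varphi_3)$ $$-(\hat\mu\varphi_1')'-i\xi\big[(\hat\mu\varphi_3)'+\hat\lambda\varphi_3'\big]+(\hat\lambda+2\hat\mu)\xi^2\varphi_1=\omega^2\varphi_1,$$ $$-((\hat\lambda+2\hat\mu)\varphi_3')'-i\xi\big[(\hat\lambda\varphi_1)'+\hat\mu\varphi_1'\big]+\hat\mu\xi^2\varphi_3=\omega^2\varphi_3,$$ with the boundary forms $a(\Phi)=i\xi\hat\lambda(0)\varphi_1(0)+(\hat\lambda(0)+2\hat\mu(0))\varphi_3'(0)$ and $b(\Phi)=i\xi\hat\mu(0)\varphi_3(0)+\hat\mu(0)\varphi_1'(0)$. Let $\Xi$ be the four-sheeted surface of points $(\xi,q_P,q_S)\in\mathbb C^3$ with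 $q_P^2=\frac{\omega^2}{\hat\lambda_I+2\hat\mu_I}-\xi^2$ and $q_S^2=\frac{\omega^2}{\hat\mu_I}-\xi^2$, and let $w_P,w_S,w_{PS}:\Xi\to\Xi$ change the sign of $q_P$, of $q_S$, and of both, respectively. On $\Xi$ let $f_P^-$, $f_S^-$ be the $C^2$ solutions of the system on $(-\infty,0]$ with $$f_P^-=\begin{pmatrix}\xi\\-q_P\end{pmatrix}e^{-iZq_P},\qquad f_S^-=\begin{pmatrix}-q_S\\-\xi\end{pmatrix}e^{-iZq_S}\qquad\text{for } Z<Z_I,$$ and let $\Delta=a(f_P^-)b(f_S^-)-a(f_S^-)b(f_P^-)$ be the Rayleigh determinant. The product $$F(\xi)=\Delta(\xi)\,\Delta(w_P\xi)\,\Delta(w_S\xi)\,\Delta(w_{PS}\xi)$$ depends only on $\xi\in\mathbb C$. Then, as a function of the variable $z=i\xi$, $F$ is in the Cartwright class with indices at most $8H$. That is, $f(z):=F(-iz)$ is entire, there are constants $C,\alpha$ with $|f(z)|\le Ce^{\alpha|z|}$ for all $z\in\mathbb C$, $$\int_{\mathbb R}\frac{\log^+|f(x)|}{1+x^2}\,dx<\infty,$$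 and the indices $\rho_\pm(F):=\limsup_{y\to+\infty}\frac{\log|f(\pm iy)|}{y}$ are finite and satisfy $\rho_+(F)\le 8H$ and $\rho_-(F)\le 8H$. -/

import Mathlib

open Complex Filter MeasureTheory Set

noncomputable section

/-- A vertically inhomogeneous isotropic elastic half-space `Z ≤ 0`: the density-normalized Lamé
parameters `lam`, `mu` as functions of `Z` (only their values for `Z ≤ 0` matter), constant below
the depth `ZI`. -/
structure ElasticMedium where
  lam : ℝ → ℝ
  mu : ℝ → ℝ
  ZI : ℝ
  ZI_neg : ZI < 0
  lam_contDiffOn : ContDiffOn ℝ 1 lam (Iic 0)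
  mu_contDiffOn : ContDiffOn ℝ 1 mu (Iic 0)
  mu_pos : ∀ Z ≤ 0, 0 < mu Z
  lam_add_two_mu_pos : ∀ Z ≤ 0, 0 < lam Z + 2 * mu Z
  lam_eq : ∀ Z ≤ ZI, lam Z = lam ZI
  mu_eq : ∀ Z ≤ ZI, mu Z = mu ZI

/-- The derivative `∂/∂Z` on the closed half-line `Z ≤ 0` (one-sided at `Z = 0`). -/
def dZ (f : ℝ → ℂ) (Z : ℝ) : ℂ := derivWithin f (Iic 0) Z

namespace ElasticMedium

variable (M : ElasticMedium) (ω : ℝ)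

/-- The thickness `H = -Z_I` of the inhomogeneous slab. -/
def H : ℝ := -M.ZI

/-- The Rayleigh operator applied to the displacement `Φ = (φ₁, φ₃)`. -/
def rayleighOp (ξ : ℂ) (Φ : ℝ → ℂ × ℂ) (Z : ℝ) : ℂ × ℂ :=
  (-dZ (fun t => (M.mu t : ℂ) * dZ (fun s => (Φ s).1) t) Z
      + ((M.lam Z : ℂ) + 2 * (M.mu Z : ℂ)) * ξ ^ 2 * (Φ Z).1
      - I * ξ * (dZ (fun t => (M.mu t : ℂ) * (Φ t).2) Z
          + (M.lam Z : ℂ) * dZ (fun s => (Φ s).2) Z),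
   -I * ξ * (dZ (fun t => (M.lam t : ℂ) * (Φ t).1) Z
          + (M.mu Z : ℂ) * dZ (fun s => (Φ s).1) Z)
      - dZ (fun t => ((M.lam t : ℂ) + 2 * (M.mu t : ℂ)) * dZ (fun s => (Φ s).2) t) Z
      + (M.mu Z : ℂ) * ξ ^ 2 * (Φ Z).2)

/-- `Φ` is a (twice continuously differentiable) solution of `HΦ = ω²Φ` on `Z ≤ 0`. -/
structure IsRayleighSolution (ξ : ℂ) (Φ : ℝ → ℂ × ℂ) : Prop where
  contDiffOn : ContDiffOn ℝ 2 Φ (Iic 0)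
  eqn : ∀ Z ≤ 0, M.rayleighOp ξ Φ Z = (ω : ℂ) ^ 2 • Φ Z

/-- The boundary operator `a(Φ)`. -/
def tractionA (ξ : ℂ) (Φ : ℝ → ℂ × ℂ) (Z : ℝ) : ℂ :=
  I * ξ * (M.lam Z : ℂ) * (Φ Z).1
    + ((M.lam Z : ℂ) + 2 * (M.mu Z : ℂ)) * dZ (fun s => (Φ s).2) Z

/-- The boundary operator `b(Φ)`. -/
def tractionB (ξ : ℂ) (Φ : ℝ → ℂ × ℂ) (Z : ℝ) : ℂ :=
  I * ξ * (M.mu Z : ℂ) * (Φ Z).2 + (M.mu Z : ℂ) * dZ (fun s => (Φ s).1) Z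

/-- `ω² / (λ_I + 2 μ_I)`, the value of `q_P² + ξ²`. -/
def kP : ℂ := (ω : ℂ) ^ 2 / ((M.lam M.ZI : ℂ) + 2 * (M.mu M.ZI : ℂ))

/-- `ω² / μ_I`, the value of `q_S² + ξ²`. -/
def kS : ℂ := (ω : ℂ) ^ 2 / (M.mu M.ZI : ℂ)

/-- The joint four-sheeted Riemann surface of the quasi-momenta `q_P`, `q_S`: a point is a complex
number `ξ` together with a choice of the two square roots. The sheets `Ξ_{±,±}` are the subsets
where `± Im q_P > 0`, `± Im q_S > 0`. -/
@[ext]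
structure Surface where
  ξ : ℂ
  qP : ℂ
  qS : ℂ
  qP_sq : qP ^ 2 = M.kP ω - ξ ^ 2
  qS_sq : qS ^ 2 = M.kS ω - ξ ^ 2

namespace Surface

variable {M ω}

/-- The sheet-changing map `w_P`. -/
def wP (x : M.Surface ω) : M.Surface ω :=
  ⟨x.ξ, -x.qP, x.qS, by rw [neg_sq]; exact x.qP_sq, x.qS_sq⟩

/-- The sheet-changing map `w_S`. -/
def wS (x : M.Surface ω) : M.Surface ω :=
  ⟨x.ξ, x.qP, -x.qS, x.qP_sq, by rw [neg_sq]; exact x.qS_sq⟩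

/-- The sheet-changing map `w_PS`. -/
def wPS (x : M.Surface ω) : M.Surface ω :=
  ⟨x.ξ, -x.qP, -x.qS, by rw [neg_sq]; exact x.qP_sq, by rw [neg_sq]; exact x.qS_sq⟩

end Surface

variable {M ω}

/-- The unperturbed Jost solution `f_{P,0}^-`. -/
def jostP0 (x : M.Surface ω) (Z : ℝ) : ℂ × ℂ :=
  exp (-(I * Z * x.qP)) • (x.ξ, -x.qP)

/-- The unperturbed Jost solution `f_{S,0}^-`. -/
def jostS0 (x : M.Surface ω) (Z : ℝ) : ℂ × ℂ :=
  exp (-(I * Z * x.qS)) • (-x.qS, -x.ξ)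

/-- The Jost solution `f_P^-`: the solution of `HΦ = ω²Φ` that equals `f_{P,0}^-` for `Z < Z_I`
(it is unique on `Z ≤ 0`; its values for `Z > 0` are irrelevant). -/
def jostP (x : M.Surface ω) : ℝ → ℂ × ℂ :=
  Classical.epsilon fun f =>
    M.IsRayleighSolution ω x.ξ f ∧ ∀ Z < M.ZI, f Z = jostP0 x Z

/-- The Jost solution `f_S^-`: the solution of `HΦ = ω²Φ` that equals `f_{S,0}^-` for `Z < Z_I`. -/
def jostS (x : M.Surface ω) : ℝ → ℂ × ℂ :=
  Classical.epsilon fun f =>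
    M.IsRayleighSolution ω x.ξ f ∧ ∀ Z < M.ZI, f Z = jostS0 x Z

/-- The boundary matrix at the free surface `Z = 0`. -/
def boundaryMatrix (x : M.Surface ω) : Matrix (Fin 2) (Fin 2) ℂ :=
  !![M.tractionA x.ξ (jostP x) 0, M.tractionA x.ξ (jostS x) 0;
     M.tractionB x.ξ (jostP x) 0, M.tractionB x.ξ (jostS x) 0]

/-- The Rayleigh determinant `Δ`, a function on the Riemann surface. -/
def rayleighDet (x : M.Surface ω) : ℂ := (boundaryMatrix x).det

/-- The product of the Rayleigh determinants over the four sheets, on the Riemann surface. -/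
def rayleighProd (x : M.Surface ω) : ℂ :=
  rayleighDet x * rayleighDet x.wP * rayleighDet x.wS * rayleighDet x.wPS

variable (M ω)

/-- A point of the surface above `ξ`, on the closure of the physical sheet:
`q_• = i √(ξ² - k_•)` with the principal square root. -/
def physicalPoint (ξ : ℂ) : M.Surface ω where
  ξ := ξ
  qP := I * (ξ ^ 2 - M.kP ω) ^ (1 / 2 : ℂ)
  qS := I * (ξ ^ 2 - M.kS ω) ^ (1 / 2 : ℂ)
  qP_sq := by
    have h : ((ξ ^ 2 - M.kP ω) ^ (1 / 2 : ℂ)) ^ 2 = ξ ^ 2 - M.kP ω := by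
      rw [one_div]; exact Complex.cpow_nat_inv_pow _ two_ne_zero
    rw [mul_pow, h, I_sq]; ring
  qS_sq := by
    have h : ((ξ ^ 2 - M.kS ω) ^ (1 / 2 : ℂ)) ^ 2 = ξ ^ 2 - M.kS ω := by
      rw [one_div]; exact Complex.cpow_nat_inv_pow _ two_ne_zero
    rw [mul_pow, h, I_sq]; ring

/-- The function `F(ξ) = Δ(ξ) Δ(w_P ξ) Δ(w_S ξ) Δ(w_PS ξ)` of the complex variable `ξ`. -/
def rayleighF (ξ : ℂ) : ℂ := rayleighProd (M.physicalPoint ω ξ)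

variable {M ω}

/-- `F` does not depend on the point chosen above `ξ`. -/
theorem rayleighF_eq (x : M.Surface ω) : M.rayleighF ω x.ξ = rayleighProd x := by
  have hP : (M.physicalPoint ω x.ξ).qP = x.qP ∨ (M.physicalPoint ω x.ξ).qP = -x.qP :=
    sq_eq_sq_iff_eq_or_eq_neg.mp ((M.physicalPoint ω x.ξ).qP_sq.trans x.qP_sq.symm)
  have hS : (M.physicalPoint ω x.ξ).qS = x.qS ∨ (M.physicalPoint ω x.ξ).qS = -x.qS :=
    sq_eq_sq_iff_eq_or_eq_neg.mp ((M.physicalPoint ω x.ξ).qS_sq.trans x.qS_sq.symm)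
  have h : M.physicalPoint ω x.ξ = x ∨ M.physicalPoint ω x.ξ = x.wP ∨
      M.physicalPoint ω x.ξ = x.wS ∨ M.physicalPoint ω x.ξ = x.wPS := by
    rcases hP with hP | hP <;> rcases hS with hS | hS
    · exact Or.inl (Surface.ext rfl hP hS)
    · exact Or.inr (Or.inr (Or.inl (Surface.ext rfl hP hS)))
    · exact Or.inr (Or.inl (Surface.ext rfl hP hS))
    · exact Or.inr (Or.inr (Or.inr (Surface.ext rfl hP hS)))
  unfold rayleighF
  rcases h with h | h | h | h <;> rw [h] <;>
    simp only [rayleighProd, Surface.wP, Surface.wS, Surface.wPS, neg_neg] <;> ring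

end ElasticMedium

/-- An entire function of exponential type. -/
def IsExponentialType (f : ℂ → ℂ) : Prop :=
  ∃ C α : ℝ, ∀ z : ℂ, ‖f z‖ ≤ C * Real.exp (α * ‖z‖)

/-- `ρ₊(f) = limsup_{y → +∞} log |f(iy)| / y`, with `log 0 = -∞`. -/
def upperIndex (f : ℂ → ℂ) : EReal :=
  limsup (fun y : ℝ => ENNReal.log ‖f (I * y)‖ₑ / (y : EReal)) atTop

/-- `ρ₋(f) = limsup_{y → +∞} log |f(-iy)| / y`, with `log 0 = -∞`. -/
def lowerIndex (f : ℂ → ℂ) : EReal :=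
  limsup (fun y : ℝ => ENNReal.log ‖f (-(I * y))‖ₑ / (y : EReal)) atTop

/-- `f` is in the Cartwright class with (finite) indices `ρ₊ = A`, `ρ₋ = B`. -/
structure IsCartwright (f : ℂ → ℂ) (A B : ℝ) : Prop where
  entire : Differentiable ℂ f
  exponentialType : IsExponentialType f
  integrable_posLog : Integrable (fun x : ℝ => Real.posLog ‖f x‖ / (1 + x ^ 2))
  upperIndex_eq : upperIndex f = (A : EReal)
  lowerIndex_eq : lowerIndex f = (B : EReal)

end

/-! Displacement and traction satisfy a first order system `Y' = A(Z, ξ) Y` without derivatives of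
the moduli and with coefficients polynomial in `ξ`, so its propagator through the slab is entire in
`ξ`. Below `Z_I` the Jost solutions are plane waves, and `Δ` is `exp(-i Z_I (q_P + q_S))` times a
`reducedDet` that depends on `q_P` and `q_S` through the initial vectors only. Over the four sheets
the exponentials cancel (`rayleighProd_eq`). As `reducedDet` is affine in each of `q_P`, `q_S` with
entire coefficients (`exists_reducedDet_eq`), the product over the signs is a polynomial in these
coefficients, `q_P²` and `q_S²`, hence entire.

The type comes from a sharp bound on the propagator. For large `ξ` the P and S exponents merge: the
leading part of the generator has eigenvalues `± ξ` in Jordan blocks of size two. The off-diagonal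
coupling, of size `|ξ|`, would spoil a direct energy estimate. Weighting half of the amplitudes by
`√|ξ|` lowers coupling and remainder to `O(√|ξ|)` (`sum_sq_norm_le_of_jordan`), so a traction grows
at most like a power of `|ξ|` times `exp(H |Re ξ| + C √|ξ|)`. Two tractions per term of the
determinant and four sheets give `|F(ξ)| ≤ C exp(8H |Re ξ| + C √|ξ|)` (`exists_norm_rayleighF_le`).
For `z = iξ`, real `z` means `Re ξ = 0`, so the logarithmic integral converges; imaginary `z` means
real `ξ`, so the indices are at most `8H`.

Finiteness of the indices requires excluding `-∞`. By Phragmén–Lindelöf and Liouville, an entire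
function of exponential type that decays faster than every exponential along a ray is zero
(`IsExponentialType.eq_zero_of_decaysAlong`). But `F(0) ≠ 0`: at `ξ = 0` the system decouples into
two real Sturm–Liouville problems, where the Wronskian of a solution with its conjugate keeps the
traction from vanishing at the surface (`reducedDet_ne_zero_of_ξ_eq_zero`). -/

noncomputable section

/-! ### Linear differential equations with an entire parameter -/

section LinearODE

variable {E : Type*} [NormedAddCommGroup E] [NormedSpace ℂ E]

/-- An interval integral of a jointly continuous function that is entire in a parameter is entire
in that parameter. -/
theorem differentiable_intervalIntegral_of_continuous [CompleteSpace E] {f : ℂ → ℝ → E}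
    (hc : Continuous (Function.uncurry f)) (hd : ∀ t, Differentiable ℂ fun ξ => f ξ t) (a b : ℝ) :
    Differentiable ℂ fun ξ => ∫ t in a..b, f ξ t := by
  intro ξ₀
  -- Radius 2 leaves room for the unit circles around the points of the unit ball, on which Cauchy's
  -- estimate bounds the parameter derivative.
  obtain ⟨C, hC⟩ := ((isCompact_closedBall ξ₀ 2).prod (isCompact_uIcc (a := a) (b := b))).exists_bound_of_continuousOn
    hc.continuousOn
  have hcξ : ∀ ξ, Continuous (f ξ) := fun ξ => hc.comp (by fun_prop : Continuous fun t => (ξ, t))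
  have hct : ∀ t, Continuous (fun ξ => f ξ t) := fun t => (hd t).continuous
  refine (intervalIntegral.hasDerivAt_integral_of_dominated_loc_of_deriv_le
    (F' := fun ξ t => deriv (fun ξ => f ξ t) ξ) (bound := fun _ => C)
    (Metric.ball_mem_nhds ξ₀ one_pos) (Eventually.of_forall fun ξ =>
      (hcξ ξ).aestronglyMeasurable) ((hcξ ξ₀).intervalIntegrable a b) ?_ ?_ ?_ ?_).2.differentiableAt
  · have h : Continuous (Function.uncurry fun t ξ => f ξ t) :=
      hc.comp (by fun_prop : Continuous fun p : ℝ × ℂ => (p.2, p.1))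
    exact ((stronglyMeasurable_deriv_with_param h).comp_measurable
      (by fun_prop : Measurable fun t : ℝ => (t, ξ₀))).aestronglyMeasurable
  · refine Eventually.of_forall fun t ht ξ hξ => ?_
    refine (Complex.norm_deriv_le_of_forall_mem_sphere_norm_le one_pos
      (hd t).diffContOnCl (fun z hz => hC (z, t) ⟨?_, uIoc_subset_uIcc ht⟩)).trans (by simp)
    have h1 : dist z ξ = 1 := hz
    have h2 : dist ξ ξ₀ < 1 := hξ
    have := dist_triangle z ξ ξ₀
    exact Metric.mem_closedBall.2 (by linarith)
  · simp
  · exact Eventually.of_forall fun t _ ξ _ => (hd t ξ).hasDerivAt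

/-- Picard iterates for the linear equation `y' = A(t, ξ) y`, `y(t₀) = y₀`. -/
def picardTerm (A : ℝ → ℂ → E →L[ℂ] E) (t₀ : ℝ) (y₀ : E) : ℕ → ℂ → ℝ → E
  | 0 => fun _ _ => y₀
  | n + 1 => fun ξ t => ∫ s in t₀..t, A s ξ (picardTerm A t₀ y₀ n ξ s)

variable {A : ℝ → ℂ → E →L[ℂ] E} {t₀ : ℝ} {y₀ : E}

theorem continuous_picardTerm (hA : Continuous (Function.uncurry A)) (n : ℕ) :
    Continuous (Function.uncurry (picardTerm A t₀ y₀ n)) := by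
  induction n with
  | zero => exact continuous_const
  | succ n ih =>
    have h : Continuous (Function.uncurry fun (p : ℂ × ℝ) (s : ℝ) =>
        A s p.1 (picardTerm A t₀ y₀ n p.1 s)) :=
      Continuous.clm_apply
        (hA.comp (by fun_prop : Continuous fun q : (ℂ × ℝ) × ℝ => (q.2, q.1.1)))
        (ih.comp (by fun_prop : Continuous fun q : (ℂ × ℝ) × ℝ => (q.1.1, q.2)))
    exact intervalIntegral.continuous_parametric_intervalIntegral_of_continuous h continuous_snd

theorem differentiable_picardTerm [CompleteSpace E] (hA : Continuous (Function.uncurry A))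
    (hd : ∀ t, Differentiable ℂ (A t)) (n : ℕ) (t : ℝ) :
    Differentiable ℂ fun ξ => picardTerm A t₀ y₀ n ξ t := by
  induction n generalizing t with
  | zero => exact differentiable_const _
  | succ n ih =>
    refine differentiable_intervalIntegral_of_continuous
      (f := fun ξ s => A s ξ (picardTerm A t₀ y₀ n ξ s)) ?_ (fun s => (hd s).clm_apply (ih s)) _ _
    exact Continuous.clm_apply
      (hA.comp (by fun_prop : Continuous fun q : ℂ × ℝ => (q.2, q.1)))
      (continuous_picardTerm hA n)

/-- Keeping the power of `|t - t₀|`, not only of `r`, in the induction is what produces the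
factorial when it is integrated. -/
theorem norm_picardTerm_le {R K r : ℝ}
    (hK : ∀ t ξ, |t - t₀| ≤ r → ‖ξ‖ ≤ R → ‖A t ξ‖ ≤ K) {ξ : ℂ} (hξ : ‖ξ‖ ≤ R) (hr : 0 ≤ r)
    (n : ℕ) (t : ℝ) (ht : |t - t₀| ≤ r) :
    ‖picardTerm A t₀ y₀ n ξ t‖ ≤ ‖y₀‖ * (K * |t - t₀|) ^ n / n.factorial := by
  induction n generalizing t with
  | zero => simp [picardTerm]
  | succ n ih =>
    have hK0 : 0 ≤ K := (norm_nonneg _).trans (hK t₀ ξ (by simpa using hr) hξ)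
    have hb : ∀ s ∈ uIoc t₀ t, ‖A s ξ (picardTerm A t₀ y₀ n ξ s)‖ ≤
        (‖y₀‖ * K ^ (n + 1) / n.factorial) * |s - t₀| ^ n := by
      intro s hs
      have hs' : |s - t₀| ≤ r := by
        refine le_trans ?_ ht
        rcases le_total t₀ t with h | h
        · rw [uIoc_of_le h] at hs
          rw [abs_of_nonneg (by linarith [hs.1]), abs_of_nonneg (by linarith)]
          linarith [hs.2]
        · rw [uIoc_of_ge h] at hs
          rw [abs_of_nonpos (by linarith [hs.2]), abs_of_nonpos (by linarith)]
          linarith [hs.1]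
      refine ((A s ξ).le_opNorm _).trans ?_
      refine (mul_le_mul (hK s ξ hs' hξ) (ih s hs') (norm_nonneg _) hK0).trans (le_of_eq ?_)
      rw [mul_pow]; ring
    have h1 : ‖picardTerm A t₀ y₀ (n + 1) ξ t‖ ≤
        ∫ s in uIoc t₀ t, (‖y₀‖ * K ^ (n + 1) / n.factorial) * |s - t₀| ^ n := by
      rw [picardTerm, intervalIntegral.norm_intervalIntegral_eq]
      refine (norm_integral_le_of_norm_le ?_ ?_)
      · exact ((by fun_prop : Continuous fun s : ℝ =>
          (‖y₀‖ * K ^ (n + 1) / n.factorial) * |s - t₀| ^ n).intervalIntegrable t₀ t).def'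
      · exact (ae_restrict_mem measurableSet_uIoc).mono hb
    refine h1.trans (le_of_eq ?_)
    rw [integral_const_mul, integral_pow_abs_sub_uIoc, mul_pow, Nat.factorial_succ]
    push_cast
    have := Nat.factorial_ne_zero n
    field_simp

/-- The solution of `y' = A(t, ξ) y`, `y(t₀) = y₀`, as a Picard series. -/
def linearFlow (A : ℝ → ℂ → E →L[ℂ] E) (t₀ : ℝ) (y₀ : E) (ξ : ℂ) (t : ℝ) : E :=
  ∑' n, picardTerm A t₀ y₀ n ξ t

theorem exists_bound_picardTerm (hA : Continuous (Function.uncurry A)) (R r : ℝ) (hr : 0 ≤ r)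
    (hR : 0 ≤ R) :
    ∃ K, 0 ≤ K ∧ (∀ t ξ, |t - t₀| ≤ r → ‖ξ‖ ≤ R → ‖A t ξ‖ ≤ K) ∧
    ∀ n t ξ, |t - t₀| ≤ r → ‖ξ‖ ≤ R →
      ‖picardTerm A t₀ y₀ n ξ t‖ ≤ ‖y₀‖ * ((K * r) ^ n / n.factorial) := by
  obtain ⟨K, hK⟩ := ((isCompact_closedBall t₀ r).prod
    (isCompact_closedBall (0 : ℂ) R)).exists_bound_of_continuousOn hA.continuousOn
  have hK' : ∀ t ξ, |t - t₀| ≤ r → ‖ξ‖ ≤ R → ‖A t ξ‖ ≤ K := fun t ξ ht hξ =>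
    hK (t, ξ) ⟨by simpa [Real.dist_eq] using ht, by simpa using hξ⟩
  have hK0 : 0 ≤ K := (norm_nonneg _).trans (hK' t₀ 0 (by simpa using hr) (by simpa using hR))
  refine ⟨K, hK0, hK', fun n t ξ ht hξ => (norm_picardTerm_le hK' hξ hr n t ht).trans ?_⟩
  rw [mul_div_assoc]
  gcongr

theorem summable_exp_majorant (c x : ℝ) : Summable fun n : ℕ => c * (x ^ n / n.factorial) :=
  (Real.summable_pow_div_factorial x).mul_left c

theorem linearFlow_init (ξ : ℂ) : linearFlow A t₀ y₀ ξ t₀ = y₀ := by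
  rw [linearFlow, tsum_eq_single 0]
  · rfl
  · rintro (_ | n) h
    · exact absurd rfl h
    · simp [picardTerm]

/-- The exponential majorant makes the Picard series converge uniformly for bounded `ξ`, and a
locally uniform limit of entire functions is entire. -/
theorem differentiable_linearFlow [CompleteSpace E] (hA : Continuous (Function.uncurry A))
    (hd : ∀ t, Differentiable ℂ (A t)) (t : ℝ) :
    Differentiable ℂ fun ξ => linearFlow A t₀ y₀ ξ t := by
  intro ξ₀
  obtain ⟨K, -, -, hK⟩ := exists_bound_picardTerm (t₀ := t₀) (y₀ := y₀) hA (‖ξ₀‖ + 1) |t - t₀|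
    (abs_nonneg _) (by positivity)
  have h := differentiableOn_tsum_of_summable_norm (F := fun n ξ => picardTerm A t₀ y₀ n ξ t)
    (summable_exp_majorant ‖y₀‖ (K * |t - t₀|))
    (fun n => (differentiable_picardTerm hA hd n t).differentiableOn) Metric.isOpen_ball
    (U := Metric.ball 0 (‖ξ₀‖ + 1))
    (fun n w hw => hK n t w le_rfl (by simpa using (mem_ball_zero_iff.1 hw).le))
  exact h.differentiableAt (Metric.isOpen_ball.mem_nhds (by simp))

theorem hasDerivAt_linearFlow [CompleteSpace E] (hA : Continuous (Function.uncurry A)) (ξ : ℂ) (t : ℝ) :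
    HasDerivAt (linearFlow A t₀ y₀ ξ) (A t ξ (linearFlow A t₀ y₀ ξ t)) t := by
  set r := |t - t₀| + 1 with hr
  have hr0 : 0 ≤ r := by positivity
  obtain ⟨K, hK0, hKA, hK⟩ := exists_bound_picardTerm (t₀ := t₀) (y₀ := y₀) hA ‖ξ‖ r hr0
    (norm_nonneg _)
  have hcξ : ∀ n, Continuous (picardTerm A t₀ y₀ n ξ) := fun n =>
    (continuous_picardTerm hA n).comp (by fun_prop : Continuous fun t : ℝ => (ξ, t))
  have hAξ : Continuous fun s => A s ξ := hA.comp (by fun_prop : Continuous fun t : ℝ => (t, ξ))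
  have hsum : ∀ s, |s - t₀| ≤ r → Summable fun n => picardTerm A t₀ y₀ n ξ s := fun s hs =>
    .of_norm_bounded (summable_exp_majorant ‖y₀‖ (K * r)) fun n => hK n s ξ hs le_rfl
  -- The derivative of the constant term is 0 and that of term `n + 1` is `A` applied to term `n`.
  -- After this index shift the differentiated series is `A` applied to the original one.
  let g' : ℕ → ℝ → E := fun n s => n.casesOn 0 fun k => A s ξ (picardTerm A t₀ y₀ k ξ s)
  let u : ℕ → ℝ := fun n => n.casesOn 0 fun k => K * (‖y₀‖ * ((K * r) ^ k / k.factorial))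
  have hu : Summable u :=
    (summable_nat_add_iff 1).1 ((summable_exp_majorant ‖y₀‖ (K * r)).mul_left K)
  have hmem : ∀ s, s ∈ Metric.ball t₀ r → |s - t₀| ≤ r := fun s hs =>
    (by simpa [Real.dist_eq] using hs : |s - t₀| < r).le
  have htm : t ∈ Metric.ball t₀ r := by simp [Real.dist_eq, hr]
  have h := hasDerivAt_tsum_of_isPreconnected (g := fun n s => picardTerm A t₀ y₀ n ξ s)
    (g' := g') (u := u) (t := Metric.ball t₀ r) (y₀ := t) (y := t) hu Metric.isOpen_ball
    (convex_ball t₀ r).isPreconnected ?_ ?_ htm (hsum t (hmem t htm)) htm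
  · refine h.congr_deriv ?_
    have h0 : ∑' n, g' n t = ∑' n, A t ξ (picardTerm A t₀ y₀ n ξ t) := by
      have hs : Summable fun n => g' n t :=
        (summable_nat_add_iff 1).1 ((A t ξ).summable (hsum t (hmem t htm)))
      rw [hs.tsum_eq_zero_add]
      simp [g']
    rw [h0, linearFlow, (A t ξ).map_tsum (hsum t (hmem t htm))]
  · rintro (_ | n) s hs
    · exact hasDerivAt_const _ _
    · have hc : Continuous fun s => A s ξ (picardTerm A t₀ y₀ n ξ s) := hAξ.clm_apply (hcξ n)
      exact intervalIntegral.integral_hasDerivAt_right (hc.intervalIntegrable _ _)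
        (hc.stronglyMeasurableAtFilter _ _) hc.continuousAt
  · rintro (_ | n) s hs
    · simp [g', u]
    · exact ((A s ξ).le_opNorm _).trans (mul_le_mul (hKA s ξ (hmem s hs) le_rfl)
        (hK n s ξ (hmem s hs) le_rfl) (norm_nonneg _) hK0)

end LinearODE

/-! ### Energy estimates for first order systems -/

section Growth

/-- Energy estimate for a weakly coupled system `uᵢ' = eᵢ ξ uᵢ + ρᵢ` with `|eᵢ| ≤ 1`. -/
theorem sum_sq_norm_le_mul_exp {ι : Type*} [Fintype ι] {u ρ : ι → ℝ → ℂ} {e : ι → ℝ} {ξ : ℂ}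
    {K a b : ℝ} (hab : a ≤ b) (he : ∀ i, |e i| ≤ 1)
    (hu : ∀ i, ∀ t ∈ Icc a b, HasDerivWithinAt (u i) (e i * ξ * u i t + ρ i t) (Icc a b) t)
    (hρ : ∀ i, ∀ t ∈ Icc a b, ‖ρ i t‖ ≤ K * ∑ j, ‖u j t‖) :
    ∑ i, ‖u i b‖ ^ 2 ≤
      (∑ i, ‖u i a‖ ^ 2) * Real.exp ((2 * |ξ.re| + 2 * (K * Fintype.card ι)) * (b - a)) := by
  rcases isEmpty_or_nonempty ι with hι | ⟨⟨i₀⟩⟩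
  · simp
  set c := 2 * |ξ.re| + 2 * (K * Fintype.card ι) with hc
  set N : ℝ → ℝ := fun t => ∑ i, ‖u i t‖ ^ 2 with hN
  have hder : ∀ t ∈ Icc a b, HasDerivWithinAt N
      (∑ i, 2 * inner ℝ (u i t) (e i * ξ * u i t + ρ i t)) (Icc a b) t := fun t ht =>
    HasDerivWithinAt.fun_sum fun i _ => (hu i t ht).norm_sq
  have hbound : ∀ t ∈ Icc a b,
      ∑ i, 2 * inner ℝ (u i t) (e i * ξ * u i t + ρ i t) ≤ c * N t := by
    intro t ht
    have h1 : ∀ i, 2 * inner ℝ (u i t) (e i * ξ * u i t + ρ i t) ≤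
        2 * |ξ.re| * ‖u i t‖ ^ 2 + 2 * (‖u i t‖ * (K * ∑ j, ‖u j t‖)) := by
      intro i
      have h2 : inner ℝ (u i t) (e i * ξ * u i t) = e i * ξ.re * ‖u i t‖ ^ 2 := by
        rw [Complex.inner, ← Complex.normSq_eq_norm_sq, Complex.normSq_apply]
        simp
        ring
      have h3 : e i * ξ.re ≤ |ξ.re| := by
        refine (le_abs_self _).trans ?_
        rw [abs_mul]
        exact mul_le_of_le_one_left (abs_nonneg _) (he i)
      have h4 := (real_inner_le_norm (u i t) (ρ i t)).trans
        (mul_le_mul_of_nonneg_left (hρ i t ht) (norm_nonneg _))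
      rw [inner_add_right, h2]
      nlinarith [mul_le_mul_of_nonneg_right h3 (sq_nonneg ‖u i t‖)]
    have hK : 0 ≤ K * ∑ j, ‖u j t‖ := (norm_nonneg _).trans (hρ i₀ t ht)
    have h5 : (∑ j, ‖u j t‖) * (K * ∑ j, ‖u j t‖) ≤ K * Fintype.card ι * N t := by
      -- The sign of `K` is known only where the sum of norms is positive; where the sum vanishes,
      -- so does the energy.
      rcases (Finset.sum_nonneg fun j (_ : j ∈ Finset.univ) => norm_nonneg (u j t)).eq_or_lt
        with h0 | h0
      · have : N t = 0 := by
          have hz := (Finset.sum_eq_zero_iff_of_nonneg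
            fun j (_ : j ∈ Finset.univ) => norm_nonneg (u j t)).1 h0.symm
          exact Finset.sum_eq_zero fun i hi => by rw [hz i hi]; simp
        rw [← h0, this]; simp
      · have hK0 : 0 ≤ K := nonneg_of_mul_nonneg_left hK h0
        have := sq_sum_le_card_mul_sum_sq (s := Finset.univ) (f := fun j => ‖u j t‖)
        rw [Finset.card_univ] at this
        calc _ = K * (∑ j, ‖u j t‖) ^ 2 := by ring
          _ ≤ K * (Fintype.card ι * N t) := mul_le_mul_of_nonneg_left this hK0
          _ = _ := by ring
    calc _ ≤ ∑ i, (2 * |ξ.re| * ‖u i t‖ ^ 2 + 2 * (‖u i t‖ * (K * ∑ j, ‖u j t‖))) :=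
          Finset.sum_le_sum fun i _ => h1 i
      _ = 2 * |ξ.re| * N t + 2 * ((∑ j, ‖u j t‖) * (K * ∑ j, ‖u j t‖)) := by
          rw [Finset.sum_add_distrib, ← Finset.mul_sum, ← Finset.mul_sum, ← Finset.sum_mul]
      _ ≤ c * N t := by rw [hc]; nlinarith
  -- Grönwall's inequality in integrated form.
  have hanti : AntitoneOn (fun t => N t * Real.exp (-c * t)) (Icc a b) := by
    have hd : ∀ t ∈ Icc a b, HasDerivWithinAt (fun t => N t * Real.exp (-c * t))
        ((∑ i, 2 * inner ℝ (u i t) (e i * ξ * u i t + ρ i t)) * Real.exp (-c * t) +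
          N t * (Real.exp (-c * t) * (-c * 1))) (Icc a b) t := fun t ht =>
      (hder t ht).mul (((hasDerivAt_id t).const_mul (-c)).exp.hasDerivWithinAt)
    refine antitoneOn_of_hasDerivWithinAt_nonpos (convex_Icc a b)
      (fun t ht => (hd t ht).continuousWithinAt)
      (fun t ht => (hd t (interior_subset ht)).mono interior_subset) fun t ht => ?_
    have := mul_le_mul_of_nonneg_right (hbound t (interior_subset ht)) (Real.exp_pos (-c * t)).le
    nlinarith
  have h := hanti (left_mem_Icc.2 hab) (right_mem_Icc.2 hab) hab
  have h' := mul_le_mul_of_nonneg_right h (Real.exp_pos (c * b)).le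
  simp only [mul_assoc, ← Real.exp_add] at h'
  rw [show -c * b + c * b = 0 by ring, Real.exp_zero, mul_one,
    show -c * a + c * b = c * (b - a) by ring] at h'
  exact h'

theorem norm_add_sq_add_norm_sub_sq (x y : ℂ) :
    ‖x + y‖ ^ 2 + ‖x - y‖ ^ 2 = 2 * (‖x‖ ^ 2 + ‖y‖ ^ 2) := by
  have := parallelogram_law_with_norm ℝ x y
  nlinarith

theorem norm_add_norm_le_norm_add_add_norm_sub (x y : ℂ) :
    ‖x‖ + ‖y‖ ≤ ‖x + y‖ + ‖x - y‖ := by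
  have h1 : ‖x‖ ≤ (‖x + y‖ + ‖x - y‖) / 2 := by
    have := norm_add_le (x + y) (x - y)
    rw [show x + y + (x - y) = 2 * x by ring, norm_mul, Complex.norm_ofNat] at this
    linarith
  have h2 : ‖y‖ ≤ (‖x + y‖ + ‖x - y‖) / 2 := by
    have := norm_sub_le (x + y) (x - y)
    rw [show x + y - (x - y) = 2 * y by ring, norm_mul, Complex.norm_ofNat] at this
    linarith
  linarith

/-- Growth of a system whose principal part `ξ B` has the eigenvalues `± ξ` with Jordan blocks of
size two: the coupling and the lower order terms only cost `exp (C √|ξ|)`. -/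
theorem sum_sq_norm_le_of_jordan {x r : Fin 4 → ℝ → ℂ} {κ : ℝ → ℂ} {ξ : ℂ} {C a b : ℝ}
    (hab : a ≤ b) (hξ : 1 ≤ ‖ξ‖) (hκ : ∀ t ∈ Icc a b, ‖κ t‖ ≤ C)
    (hr : ∀ i, ∀ t ∈ Icc a b, ‖r i t‖ ≤ C * ∑ j, ‖x j t‖)
    (h0 : ∀ t ∈ Icc a b,
      HasDerivWithinAt (x 0) (ξ * (x 1 t + κ t * x 2 t) + r 0 t) (Icc a b) t)
    (h1 : ∀ t ∈ Icc a b,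
      HasDerivWithinAt (x 1) (ξ * (x 0 t + κ t * x 3 t) + r 1 t) (Icc a b) t)
    (h2 : ∀ t ∈ Icc a b, HasDerivWithinAt (x 2) (ξ * x 3 t + r 2 t) (Icc a b) t)
    (h3 : ∀ t ∈ Icc a b, HasDerivWithinAt (x 3) (ξ * x 2 t + r 3 t) (Icc a b) t) :
    ∑ i, ‖x i b‖ ^ 2 ≤ ‖ξ‖ * (∑ i, ‖x i a‖ ^ 2) *
      Real.exp ((2 * |ξ.re| + 24 * C * √‖ξ‖) * (b - a)) := by
  set s := √‖ξ‖ with hs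
  have hs1 : 1 ≤ s := Real.one_le_sqrt.2 hξ
  have hs0 : 0 < s := one_pos.trans_le hs1
  have hss : s * s = ‖ξ‖ := Real.mul_self_sqrt (norm_nonneg _)
  have hsc : (s : ℂ) ≠ 0 := by exact_mod_cast hs0.ne'
  have hC : 0 ≤ C := (norm_nonneg _).trans (hκ a (left_mem_Icc.2 hab))
  -- Sums and differences diagonalize the principal part. The weight `s = √‖ξ‖` balances the two
  -- perturbations: the coupling `ξ κ` is divided by `s`, the lower order terms are at worst
  -- multiplied by `s`, so both are `O(s)`.
  let u : Fin 4 → ℝ → ℂ := ![fun t => x 0 t + x 1 t, fun t => x 0 t - x 1 t,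
    fun t => s * (x 2 t + x 3 t), fun t => s * (x 2 t - x 3 t)]
  let ρ : Fin 4 → ℝ → ℂ := ![fun t => ξ / s * κ t * u 2 t + (r 0 t + r 1 t),
    fun t => ξ / s * κ t * u 3 t + (r 0 t - r 1 t),
    fun t => s * (r 2 t + r 3 t), fun t => s * (r 2 t - r 3 t)]
  let e : Fin 4 → ℝ := ![1, -1, 1, -1]
  have hsx : ∀ t, ∑ j, ‖x j t‖ ≤ ∑ j, ‖u j t‖ := by
    intro t
    simp only [Fin.sum_univ_four, u]
    simp only [Matrix.cons_val, norm_mul, Complex.norm_real, Real.norm_of_nonneg hs0.le]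
    have e1 := norm_add_norm_le_norm_add_add_norm_sub (x 0 t) (x 1 t)
    have e2 := norm_add_norm_le_norm_add_add_norm_sub (x 2 t) (x 3 t)
    nlinarith [norm_nonneg (x 2 t + x 3 t), norm_nonneg (x 2 t - x 3 t)]
  have hξs : ‖ξ / s‖ = s := by
    rw [norm_div, Complex.norm_real, Real.norm_of_nonneg hs0.le, ← hss]
    field_simp
  have hρ : ∀ i, ∀ t ∈ Icc a b, ‖ρ i t‖ ≤ 3 * C * s * ∑ j, ‖u j t‖ := by
    intro i t ht
    have hS0 : 0 ≤ ∑ j, ‖u j t‖ := Finset.sum_nonneg fun j _ => norm_nonneg _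
    have hr' : ∀ i, ‖r i t‖ ≤ C * ∑ j, ‖u j t‖ := fun i =>
      (hr i t ht).trans (mul_le_mul_of_nonneg_left (hsx t) hC)
    have hu' : ∀ i, ‖u i t‖ ≤ ∑ j, ‖u j t‖ := fun i =>
      Finset.single_le_sum (f := fun j => ‖u j t‖) (fun j _ => norm_nonneg _) (Finset.mem_univ i)
    have hm : ∀ i, ‖ξ / s * κ t * u i t‖ ≤ s * C * ∑ j, ‖u j t‖ := by
      intro i
      rw [norm_mul, norm_mul, hξs]
      exact mul_le_mul (mul_le_mul_of_nonneg_left (hκ t ht) hs0.le) (hu' i) (norm_nonneg _)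
        (by positivity)
    have hCS : C * ∑ j, ‖u j t‖ ≤ s * C * ∑ j, ‖u j t‖ := by
      have := mul_nonneg hC hS0
      nlinarith
    have hCS0 : 0 ≤ s * C * ∑ j, ‖u j t‖ := by positivity
    have hadd : ∀ i j, ‖r i t + r j t‖ ≤ 2 * (C * ∑ j, ‖u j t‖) := fun i j =>
      (norm_add_le _ _).trans (by linarith [hr' i, hr' j])
    have hsub : ∀ i j, ‖r i t - r j t‖ ≤ 2 * (C * ∑ j, ‖u j t‖) := fun i j =>
      (norm_sub_le _ _).trans (by linarith [hr' i, hr' j])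
    fin_cases i
    · exact (norm_add_le _ _).trans (by linarith [hm 2, hadd 0 1])
    · exact (norm_add_le _ _).trans (by linarith [hm 3, hsub 0 1])
    · change ‖(s : ℂ) * (r 2 t + r 3 t)‖ ≤ _
      rw [norm_mul, Complex.norm_real, Real.norm_of_nonneg hs0.le]
      nlinarith [mul_le_mul_of_nonneg_left (hadd 2 3) hs0.le]
    · change ‖(s : ℂ) * (r 2 t - r 3 t)‖ ≤ _
      rw [norm_mul, Complex.norm_real, Real.norm_of_nonneg hs0.le]
      nlinarith [mul_le_mul_of_nonneg_left (hsub 2 3) hs0.le]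
  have hu : ∀ i, ∀ t ∈ Icc a b,
      HasDerivWithinAt (u i) (e i * ξ * u i t + ρ i t) (Icc a b) t := by
    intro i t ht
    fin_cases i
    · refine ((h0 t ht).add (h1 t ht)).congr_deriv ?_
      simp [u, ρ, e]; field_simp; ring
    · refine ((h0 t ht).sub (h1 t ht)).congr_deriv ?_
      simp [u, ρ, e]; field_simp; ring
    · refine (((h2 t ht).add (h3 t ht)).const_mul (s : ℂ)).congr_deriv ?_
      simp [u, ρ, e]; ring
    · refine (((h2 t ht).sub (h3 t ht)).const_mul (s : ℂ)).congr_deriv ?_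
      simp [u, ρ, e]; ring
  have he : ∀ i, |e i| ≤ 1 := by intro i; fin_cases i <;> simp [e]
  have key := sum_sq_norm_le_mul_exp hab he hu hρ
  have hsq : ∀ t, ∑ i, ‖u i t‖ ^ 2 = 2 * (‖x 0 t‖ ^ 2 + ‖x 1 t‖ ^ 2) +
      2 * ‖ξ‖ * (‖x 2 t‖ ^ 2 + ‖x 3 t‖ ^ 2) := by
    intro t
    simp only [Fin.sum_univ_four, u]
    simp only [Matrix.cons_val, norm_mul, Complex.norm_real, Real.norm_of_nonneg hs0.le, mul_pow]
    rw [← hss, ← norm_add_sq_add_norm_sub_sq]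
    have := norm_add_sq_add_norm_sub_sq (x 2 t) (x 3 t)
    linear_combination s ^ 2 * this
  rw [hsq, hsq, Fintype.card_fin] at key
  rw [Fin.sum_univ_four, Fin.sum_univ_four]
  have hE : (2 * |ξ.re| + 2 * (3 * C * s * (4 : ℕ))) * (b - a) =
    (2 * |ξ.re| + 24 * C * s) * (b - a) := by push_cast; ring
  rw [hE] at key
  have hpos := (Real.exp_pos ((2 * |ξ.re| + 24 * C * s) * (b - a))).le
  have k1 : ‖x 0 b‖ ^ 2 + ‖x 1 b‖ ^ 2 + ‖x 2 b‖ ^ 2 + ‖x 3 b‖ ^ 2 ≤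
      (2 * (‖x 0 b‖ ^ 2 + ‖x 1 b‖ ^ 2) + 2 * ‖ξ‖ * (‖x 2 b‖ ^ 2 + ‖x 3 b‖ ^ 2)) / 2 := by
    nlinarith [sq_nonneg ‖x 2 b‖, sq_nonneg ‖x 3 b‖]
  have k2 : (2 * (‖x 0 a‖ ^ 2 + ‖x 1 a‖ ^ 2) + 2 * ‖ξ‖ * (‖x 2 a‖ ^ 2 + ‖x 3 a‖ ^ 2)) / 2 ≤
      ‖ξ‖ * (‖x 0 a‖ ^ 2 + ‖x 1 a‖ ^ 2 + ‖x 2 a‖ ^ 2 + ‖x 3 a‖ ^ 2) := by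
    nlinarith [sq_nonneg ‖x 0 a‖, sq_nonneg ‖x 1 a‖]
  have k3 := mul_le_mul_of_nonneg_right k2 hpos
  linarith

end Growth

/-! ### The displacement–traction system and its equivalence with the Rayleigh system -/

namespace ElasticMedium

variable (M : ElasticMedium) (ω : ℝ)

/-- The elementary operator sending `y` to `y j` times the `i`-th basis vector. -/
def elemOp (i j : Fin 4) : (Fin 4 → ℂ) →L[ℂ] (Fin 4 → ℂ) :=
  (ContinuousLinearMap.single ℂ (fun _ : Fin 4 => ℂ) i).comp (ContinuousLinearMap.proj j)

@[simp]
theorem elemOp_apply (i j : Fin 4) (y : Fin 4 → ℂ) : elemOp i j y = Pi.single i (y j) := rfl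

/-- The P-wave modulus `λ + 2μ`. -/
def pMod (Z : ℝ) : ℝ := M.lam Z + 2 * M.mu Z

/-- The generator of the first order system for displacement and traction, with the coefficients
continued by their value at `0`. -/
def stressOp (t : ℝ) (ξ : ℂ) : (Fin 4 → ℂ) →L[ℂ] (Fin 4 → ℂ) :=
  (M.mu (min t 0) : ℂ)⁻¹ • elemOp 0 2 + (-(I * ξ)) • elemOp 0 1
    + (M.pMod (min t 0) : ℂ)⁻¹ • elemOp 1 3
    + (-(I * ξ * M.lam (min t 0)) * (M.pMod (min t 0) : ℂ)⁻¹) • elemOp 1 0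
    + (-(I * ξ * M.lam (min t 0)) * (M.pMod (min t 0) : ℂ)⁻¹) • elemOp 2 3
    + (ξ ^ 2 * (4 * M.mu (min t 0) * (M.lam (min t 0) + M.mu (min t 0)))
        * (M.pMod (min t 0) : ℂ)⁻¹ - (ω : ℂ) ^ 2) • elemOp 2 0
    + (-(I * ξ)) • elemOp 3 2 + (-(ω : ℂ) ^ 2) • elemOp 3 1

theorem stressOp_apply {t : ℝ} (ht : t ≤ 0) (ξ : ℂ) (y : Fin 4 → ℂ) :
    M.stressOp ω t ξ y =
      ![(M.mu t : ℂ)⁻¹ * y 2 - I * ξ * y 1,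
        (M.pMod t : ℂ)⁻¹ * (y 3 - I * ξ * M.lam t * y 0),
        -(I * ξ * M.lam t) * (M.pMod t : ℂ)⁻¹ * y 3
          + (ξ ^ 2 * (4 * M.mu t * (M.lam t + M.mu t)) * (M.pMod t : ℂ)⁻¹ - (ω : ℂ) ^ 2) * y 0,
        -(I * ξ) * y 2 - (ω : ℂ) ^ 2 * y 1] := by
  ext i
  fin_cases i <;> simp [stressOp, min_eq_left ht] <;> ring

variable {M} in
theorem mu_ne_zero {t : ℝ} (ht : t ≤ 0) : (M.mu t : ℂ) ≠ 0 := by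
  exact_mod_cast (M.mu_pos t ht).ne'

variable {M} in
theorem pMod_ne_zero {t : ℝ} (ht : t ≤ 0) : (M.pMod t : ℂ) ≠ 0 := by
  exact_mod_cast (M.lam_add_two_mu_pos t ht).ne'

theorem continuous_lam_min : Continuous fun t : ℝ => M.lam (min t 0) :=
  M.lam_contDiffOn.continuousOn.comp_continuous (by fun_prop) fun _ => mem_Iic.2 (min_le_right _ _)

theorem continuous_mu_min : Continuous fun t : ℝ => M.mu (min t 0) :=
  M.mu_contDiffOn.continuousOn.comp_continuous (by fun_prop) fun _ => mem_Iic.2 (min_le_right _ _)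

theorem continuous_stressOp : Continuous (Function.uncurry (M.stressOp ω)) := by
  have hl : Continuous fun p : ℝ × ℂ => (M.lam (min p.1 0) : ℂ) :=
    continuous_ofReal.comp (M.continuous_lam_min.comp continuous_fst)
  have hm : Continuous fun p : ℝ × ℂ => (M.mu (min p.1 0) : ℂ) :=
    continuous_ofReal.comp (M.continuous_mu_min.comp continuous_fst)
  have hp : Continuous fun p : ℝ × ℂ => (M.pMod (min p.1 0) : ℂ) := by
    simp only [pMod, ofReal_add, ofReal_mul]
    fun_prop
  have hmi := hm.inv₀ fun p => mu_ne_zero (M := M) (min_le_right p.1 0)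
  have hpi := hp.inv₀ fun p => pMod_ne_zero (M := M) (min_le_right p.1 0)
  have hξ : Continuous fun p : ℝ × ℂ => -(I * p.2) := by fun_prop
  have hξl : Continuous fun p : ℝ × ℂ =>
      -(I * p.2 * M.lam (min p.1 0)) * (M.pMod (min p.1 0) : ℂ)⁻¹ :=
    ((continuous_const.mul continuous_snd).mul hl).neg.mul hpi
  have hξc : Continuous fun p : ℝ × ℂ =>
      p.2 ^ 2 * (4 * M.mu (min p.1 0) * (M.lam (min p.1 0) + M.mu (min p.1 0)))
        * (M.pMod (min p.1 0) : ℂ)⁻¹ - (ω : ℂ) ^ 2 :=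
    (((continuous_snd.pow 2).mul ((continuous_const.mul hm).mul (hl.add hm))).mul hpi).sub
      continuous_const
  exact (((((((hmi.smul continuous_const).add (hξ.smul continuous_const)).add
    (hpi.smul continuous_const)).add (hξl.smul continuous_const)).add
    (hξl.smul continuous_const)).add (hξc.smul continuous_const)).add
    (hξ.smul continuous_const)).add continuous_const

theorem continuous_stressOp_right (ξ : ℂ) : Continuous fun t => M.stressOp ω t ξ :=
  (M.continuous_stressOp ω).uncurry_right ξ

theorem differentiable_stressOp (t : ℝ) : Differentiable ℂ (M.stressOp ω t) := by
  have hξ : Differentiable ℂ fun ξ : ℂ => -(I * ξ) := by fun_prop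
  have hξl : Differentiable ℂ fun ξ : ℂ =>
      -(I * ξ * M.lam (min t 0)) * (M.pMod (min t 0) : ℂ)⁻¹ := by fun_prop
  have hξc : Differentiable ℂ fun ξ : ℂ =>
      ξ ^ 2 * (4 * M.mu (min t 0) * (M.lam (min t 0) + M.mu (min t 0)))
        * (M.pMod (min t 0) : ℂ)⁻¹ - (ω : ℂ) ^ 2 := by fun_prop
  exact (((((((differentiable_const _).add (hξ.smul_const _)).add
    (differentiable_const _)).add (hξl.smul_const _)).add
    (hξl.smul_const _)).add (hξc.smul_const _)).add
    (hξ.smul_const _)).add (differentiable_const _)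

/-- `Y` solves the first order displacement–traction system on `Z ≤ 0`. -/
def IsStressSolution (ξ : ℂ) (Y : ℝ → Fin 4 → ℂ) : Prop :=
  ∀ Z ≤ 0, HasDerivWithinAt Y (M.stressOp ω Z ξ (Y Z)) (Iic 0) Z

variable {M ω}

namespace IsStressSolution

variable {ξ : ℂ} {Y Y' : ℝ → Fin 4 → ℂ}

theorem add (h : M.IsStressSolution ω ξ Y) (h' : M.IsStressSolution ω ξ Y') :
    M.IsStressSolution ω ξ fun Z => Y Z + Y' Z := fun Z hZ =>
  ((h Z hZ).add (h' Z hZ)).congr_deriv (map_add _ _ _).symm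

theorem smul (h : M.IsStressSolution ω ξ Y) (c : ℂ) :
    M.IsStressSolution ω ξ fun Z => c • Y Z := fun Z hZ =>
  ((h Z hZ).const_smul c).congr_deriv (map_smul _ _ _).symm

theorem continuousOn (h : M.IsStressSolution ω ξ Y) : ContinuousOn Y (Iic 0) := fun Z hZ =>
  (h Z hZ).continuousWithinAt

theorem _root_.ContinuousLinearMap.lipschitzWith_of_norm_le {E : Type*} [NormedAddCommGroup E]
    [NormedSpace ℂ E] {T : E →L[ℂ] E} {C : ℝ} (h : ‖T‖ ≤ C) : LipschitzWith C.toNNReal T :=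
  T.lipschitz.weaken (NNReal.coe_le_coe.1 (h.trans (Real.le_coe_toNNReal C)))

theorem exists_lipschitz (M : ElasticMedium) (ω : ℝ) (ξ : ℂ) (a b : ℝ) :
    ∃ K, ∀ t ∈ Icc a b, LipschitzOnWith K (fun y => M.stressOp ω t ξ y) univ := by
  obtain ⟨C, hC⟩ := (isCompact_Icc (a := a) (b := b)).exists_bound_of_continuousOn
    (M.continuous_stressOp_right ω ξ).continuousOn
  exact ⟨C.toNNReal, fun t ht => (ContinuousLinearMap.lipschitzWith_of_norm_le
    (hC t ht)).lipschitzOnWith⟩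

theorem eqOn_Icc (h : M.IsStressSolution ω ξ Y) (h' : M.IsStressSolution ω ξ Y') {a : ℝ}
    (heq : Y a = Y' a) : EqOn Y Y' (Icc a 0) := by
  obtain ⟨K, hK⟩ := exists_lipschitz M ω ξ a 0
  exact ODE_solution_unique_of_mem_Icc_right (v := fun t y => M.stressOp ω t ξ y)
    (s := fun _ => univ) (fun t ht => hK t (Ico_subset_Icc_self ht))
    (h.continuousOn.mono Icc_subset_Iic_self)
    (fun t ht => ((h t ht.2.le).hasDerivAt (Iic_mem_nhds ht.2)).hasDerivWithinAt)
    (fun _ _ => mem_univ _) (h'.continuousOn.mono Icc_subset_Iic_self)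
    (fun t ht => ((h' t ht.2.le).hasDerivAt (Iic_mem_nhds ht.2)).hasDerivWithinAt)
    (fun _ _ => mem_univ _) heq

end IsStressSolution

/-- Displacement and traction of a displacement field. -/
def stressVec (M : ElasticMedium) (ξ : ℂ) (Φ : ℝ → ℂ × ℂ) (Z : ℝ) : Fin 4 → ℂ :=
  ![(Φ Z).1, (Φ Z).2, M.tractionB ξ Φ Z, M.tractionA ξ Φ Z]

theorem uniqueDiffWithinAt_Iic_zero {Z : ℝ} (hZ : Z ≤ 0) : UniqueDiffWithinAt ℝ (Iic 0) Z :=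
  uniqueDiffOn_Iic 0 Z hZ

theorem _root_.HasDerivWithinAt.dZ_eq {f : ℝ → ℂ} {f' : ℂ} {Z : ℝ} (hZ : Z ≤ 0)
    (h : HasDerivWithinAt f f' (Iic 0) Z) : dZ f Z = f' :=
  h.derivWithin (uniqueDiffWithinAt_Iic_zero hZ)

theorem _root_.ContDiffOn.hasDerivWithinAt_dZ {f : ℝ → ℂ} {n : WithTop ℕ∞} {Z : ℝ}
    (hf : ContDiffOn ℝ n f (Iic 0)) (hn : n ≠ 0) (hZ : Z ≤ 0) :
    HasDerivWithinAt f (dZ f Z) (Iic 0) Z :=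
  (hf.differentiableOn hn Z hZ).hasDerivWithinAt

theorem contDiffOn_ofReal_lam (M : ElasticMedium) :
    ContDiffOn ℝ 1 (fun t => (M.lam t : ℂ)) (Iic 0) :=
  Complex.ofRealCLM.contDiff.comp_contDiffOn M.lam_contDiffOn

theorem contDiffOn_ofReal_mu (M : ElasticMedium) :
    ContDiffOn ℝ 1 (fun t => (M.mu t : ℂ)) (Iic 0) :=
  Complex.ofRealCLM.contDiff.comp_contDiffOn M.mu_contDiffOn

theorem pMod_coe (M : ElasticMedium) (Z : ℝ) :
    (M.pMod Z : ℂ) = (M.lam Z : ℂ) + 2 * (M.mu Z : ℂ) := by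
  simp [pMod]

/-- Displacement and traction of a solution of the Rayleigh system solve the first order
system. -/
theorem IsRayleighSolution.isStressSolution {ξ : ℂ} {Φ : ℝ → ℂ × ℂ}
    (h : M.IsRayleighSolution ω ξ Φ) : M.IsStressSolution ω ξ (M.stressVec ξ Φ) := by
  intro Z hZ
  have c1 : ContDiffOn ℝ 2 (fun s => (Φ s).1) (Iic 0) := contDiff_fst.comp_contDiffOn h.contDiffOn
  have c2 : ContDiffOn ℝ 2 (fun s => (Φ s).2) (Iic 0) := contDiff_snd.comp_contDiffOn h.contDiffOn
  have d1 : ContDiffOn ℝ 1 (fun t => dZ (fun s => (Φ s).1) t) (Iic 0) :=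
    c1.derivWithin (uniqueDiffOn_Iic 0) (by norm_num)
  have d2 : ContDiffOn ℝ 1 (fun t => dZ (fun s => (Φ s).2) t) (Iic 0) :=
    c2.derivWithin (uniqueDiffOn_Iic 0) (by norm_num)
  have hl := contDiffOn_ofReal_lam M
  have hm := contDiffOn_ofReal_mu M
  have one_ne : (1 : WithTop ℕ∞) ≠ 0 := one_ne_zero
  have e1 := (hm.mul d1).hasDerivWithinAt_dZ one_ne hZ
  have e2 := (hm.mul (c2.of_le (by norm_num))).hasDerivWithinAt_dZ one_ne hZ
  have e3 := (hl.mul (c1.of_le (by norm_num))).hasDerivWithinAt_dZ one_ne hZ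
  have e4 := ((hl.add (contDiffOn_const.mul hm)).mul d2).hasDerivWithinAt_dZ
    (f := fun t => ((M.lam t : ℂ) + 2 * (M.mu t : ℂ)) * dZ (fun s => (Φ s).2) t) one_ne hZ
  have f1 := c1.hasDerivWithinAt_dZ two_ne_zero hZ
  have f2 := c2.hasDerivWithinAt_dZ two_ne_zero hZ
  have heq := h.eqn Z hZ
  simp only [rayleighOp, Prod.ext_iff, Prod.smul_fst, Prod.smul_snd, smul_eq_mul] at heq
  obtain ⟨q1, q2⟩ := heq
  have hμ := mu_ne_zero (M := M) hZ
  have hp := pMod_ne_zero (M := M) hZ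
  have hp' := hp
  rw [pMod_coe] at hp'
  rw [M.stressOp_apply ω hZ, pMod_coe, hasDerivWithinAt_pi]
  intro i
  fin_cases i
  · refine f1.congr_deriv ?_
    simp [stressVec, tractionB]
    field_simp
    ring
  · refine f2.congr_deriv ?_
    simp [stressVec, tractionA]
    field_simp
  · have hB := (e2.const_mul (I * ξ)).add e1
    refine (hB.congr_of_mem (fun t _ => ?_) hZ).congr_deriv ?_
    · simp [stressVec, tractionB]; ring
    · simp [stressVec, tractionA]
      have : dZ (fun t => (M.mu t : ℂ) * dZ (fun s => (Φ s).1) t) Z +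
          I * ξ * dZ (fun t => (M.mu t : ℂ) * (Φ t).2) Z =
          ((M.lam Z : ℂ) + 2 * (M.mu Z : ℂ)) * ξ ^ 2 * (Φ Z).1
          - I * ξ * (M.lam Z : ℂ) * dZ (fun s => (Φ s).2) Z - (ω : ℂ) ^ 2 * (Φ Z).1 := by
        linear_combination -q1
      rw [add_comm, this]
      field_simp
      ring_nf
      simp only [I_sq]
      ring
  · have hB := (e3.const_mul (I * ξ)).add e4
    refine (hB.congr_of_mem (fun t _ => ?_) hZ).congr_deriv ?_
    · simp [stressVec, tractionA]; ring
    · simp [stressVec, tractionB]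
      have : I * ξ * dZ (fun t => (M.lam t : ℂ) * (Φ t).1) Z +
          dZ (fun t => ((M.lam t : ℂ) + 2 * (M.mu t : ℂ)) * dZ (fun s => (Φ s).2) t) Z =
          - I * ξ * (M.mu Z : ℂ) * dZ (fun s => (Φ s).1) Z
          + (M.mu Z : ℂ) * ξ ^ 2 * (Φ Z).2 - (ω : ℂ) ^ 2 * (Φ Z).2 := by
        linear_combination -q2
      rw [this]
      ring_nf
      simp only [I_sq]
      ring

/-- The displacement part of a solution of the first order system solves the Rayleigh system. -/
theorem IsStressSolution.isRayleighSolution {ξ : ℂ} {Y : ℝ → Fin 4 → ℂ}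
    (h : M.IsStressSolution ω ξ Y) :
    M.IsRayleighSolution ω ξ (fun t => (Y t 0, Y t 1)) ∧
      ∀ Z ≤ 0, M.stressVec ξ (fun t => (Y t 0, Y t 1)) Z = Y Z := by
  have hd : ∀ Z ≤ 0, ∀ i, HasDerivWithinAt (fun t => Y t i)
      (M.stressOp ω Z ξ (Y Z) i) (Iic 0) Z := fun Z hZ => hasDerivWithinAt_pi.1 (h Z hZ)
  have h0 : ∀ Z ≤ 0, HasDerivWithinAt (fun t => Y t 0)
      ((M.mu Z : ℂ)⁻¹ * Y Z 2 - I * ξ * Y Z 1) (Iic 0) Z := fun Z hZ =>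
    (hd Z hZ 0).congr_deriv (by rw [M.stressOp_apply ω hZ]; rfl)
  have h1 : ∀ Z ≤ 0, HasDerivWithinAt (fun t => Y t 1)
      ((M.pMod Z : ℂ)⁻¹ * (Y Z 3 - I * ξ * M.lam Z * Y Z 0)) (Iic 0) Z := fun Z hZ =>
    (hd Z hZ 1).congr_deriv (by rw [M.stressOp_apply ω hZ]; rfl)
  have h2 : ∀ Z ≤ 0, HasDerivWithinAt (fun t => Y t 2)
      (-(I * ξ * M.lam Z) * (M.pMod Z : ℂ)⁻¹ * Y Z 3
        + (ξ ^ 2 * (4 * M.mu Z * (M.lam Z + M.mu Z)) * (M.pMod Z : ℂ)⁻¹ - (ω : ℂ) ^ 2) * Y Z 0)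
      (Iic 0) Z := fun Z hZ =>
    (hd Z hZ 2).congr_deriv (by rw [M.stressOp_apply ω hZ]; rfl)
  have h3 : ∀ Z ≤ 0, HasDerivWithinAt (fun t => Y t 3)
      (-(I * ξ) * Y Z 2 - (ω : ℂ) ^ 2 * Y Z 1) (Iic 0) Z := fun Z hZ =>
    (hd Z hZ 3).congr_deriv (by rw [M.stressOp_apply ω hZ]; rfl)
  have hYc : ∀ i, ContDiffOn ℝ 1 (fun t => Y t i) (Iic 0) := by
    have hco : ∀ i, ContinuousOn (fun t => Y t i) (Iic 0) := fun i Z hZ =>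
      (hd Z hZ i).continuousWithinAt
    have hop : ContinuousOn (fun Z => M.stressOp ω Z ξ (Y Z)) (Iic 0) :=
      (M.continuous_stressOp_right ω ξ).continuousOn.clm_apply h.continuousOn
    intro i
    rw [show (1 : WithTop ℕ∞) = 0 + 1 from (zero_add 1).symm,
      contDiffOn_succ_iff_derivWithin (uniqueDiffOn_Iic 0)]
    refine ⟨fun Z hZ => (hd Z hZ i).differentiableWithinAt, by simp, ?_⟩
    rw [contDiffOn_zero]
    exact (continuousOn_pi.1 hop i).congr fun Z hZ =>
      (hd Z hZ i).derivWithin (uniqueDiffWithinAt_Iic_zero hZ)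
  have hl := contDiffOn_ofReal_lam M
  have hm := contDiffOn_ofReal_mu M
  have hp : ContDiffOn ℝ 1 (fun t => (M.pMod t : ℂ)) (Iic 0) := by
    simp only [pMod_coe]
    exact hl.add (contDiffOn_const.mul hm)
  -- Regularity is gained once: `Y` is `C¹`, the moduli are `C¹`, so the right-hand sides for the
  -- two displacements are `C¹` and the displacements are `C²`. The tractions need only be `C¹`.
  have hc2 : ∀ {f g : ℝ → ℂ}, (∀ Z ≤ 0, HasDerivWithinAt f (g Z) (Iic 0) Z) →
      ContDiffOn ℝ 1 g (Iic 0) → ContDiffOn ℝ 2 f (Iic 0) := by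
    intro f g hfg hg
    rw [show (2 : WithTop ℕ∞) = 1 + 1 by norm_num,
      contDiffOn_succ_iff_derivWithin (uniqueDiffOn_Iic 0)]
    exact ⟨fun Z hZ => (hfg Z hZ).differentiableWithinAt, by simp,
      hg.congr fun Z hZ => (hfg Z hZ).derivWithin (uniqueDiffWithinAt_Iic_zero hZ)⟩
  have hvec : ∀ Z ≤ 0, M.stressVec ξ (fun t => (Y t 0, Y t 1)) Z = Y Z := by
    intro Z hZ
    have hμ := mu_ne_zero (M := M) hZ
    have hp := pMod_ne_zero (M := M) hZ
    ext i
    fin_cases i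
    · rfl
    · rfl
    · simp [stressVec, tractionB, (h0 Z hZ).dZ_eq hZ]
      field_simp
      ring
    · simp [stressVec, tractionA, (h1 Z hZ).dZ_eq hZ, ← pMod_coe]
      field_simp
      ring
  refine ⟨⟨?_, ?_⟩, hvec⟩
  · refine ContDiffOn.prodMk (hc2 h0 ?_) (hc2 h1 ?_)
    · exact ((hm.inv fun Z hZ => mu_ne_zero hZ).mul (hYc 2)).sub (contDiffOn_const.mul (hYc 1))
    · exact (hp.inv fun Z hZ => pMod_ne_zero hZ).mul
        ((hYc 3).sub ((contDiffOn_const.mul hl).mul (hYc 0)))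
  · intro Z hZ
    have one_ne : (1 : WithTop ℕ∞) ≠ 0 := one_ne_zero
    have e2 := (hm.mul (hYc 1)).hasDerivWithinAt_dZ one_ne hZ
    have e3 := (hl.mul (hYc 0)).hasDerivWithinAt_dZ one_ne hZ
    -- `μ φ₁'` is the traction `Y 2` minus `iξ μ φ₃`, so its derivative comes from the third
    -- equation.
    have e1 : dZ (fun t => (M.mu t : ℂ) * dZ (fun s => Y s 0) t) Z = _ :=
      HasDerivWithinAt.dZ_eq hZ (((h2 Z hZ).sub (e2.const_mul (I * ξ))).congr_of_mem
        (fun t ht => by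
          have hμ := mu_ne_zero (M := M) ht
          rw [(h0 t ht).dZ_eq ht]
          simp only [Pi.sub_apply]
          field_simp) hZ)
    have e4 : dZ (fun t => ((M.lam t : ℂ) + 2 * (M.mu t : ℂ)) * dZ (fun s => Y s 1) t) Z = _ :=
      HasDerivWithinAt.dZ_eq hZ (((h3 Z hZ).sub (e3.const_mul (I * ξ))).congr_of_mem
        (fun t ht => by
          have hp := pMod_ne_zero (M := M) ht
          rw [(h1 t ht).dZ_eq ht, ← pMod_coe]
          simp only [Pi.sub_apply]
          field_simp) hZ)
    have hμ := mu_ne_zero (M := M) hZ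
    have hp := pMod_ne_zero (M := M) hZ
    rw [pMod_coe] at hp
    ext
    · simp only [rayleighOp, e1, Prod.smul_fst, smul_eq_mul, (h1 Z hZ).dZ_eq hZ, pMod_coe]
      field_simp
      ring_nf
      simp only [I_sq]
      ring
    · simp only [rayleighOp, e4, Prod.smul_snd, smul_eq_mul, (h0 Z hZ).dZ_eq hZ]
      field_simp
      ring_nf
      simp only [I_sq]
      ring

end ElasticMedium

/-! ### Propagator, Jost solutions and entireness of `F` -/

namespace ElasticMedium

variable {M : ElasticMedium} {ω : ℝ}

theorem isStressSolution_linearFlow (ξ : ℂ) (v : Fin 4 → ℂ) :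
    M.IsStressSolution ω ξ (linearFlow (M.stressOp ω) M.ZI v ξ) := fun Z _ =>
  (hasDerivAt_linearFlow (M.continuous_stressOp ω) ξ Z).hasDerivWithinAt

variable (M ω) in
/-- The propagator of displacement and traction through the slab, from `Z_I` to `0`. -/
def propagate (ξ : ℂ) (v : Fin 4 → ℂ) : Fin 4 → ℂ :=
  linearFlow (M.stressOp ω) M.ZI v ξ 0

theorem differentiable_propagate (v : Fin 4 → ℂ) :
    Differentiable ℂ fun ξ => M.propagate ω ξ v :=
  differentiable_linearFlow (M.continuous_stressOp ω) (M.differentiable_stressOp ω) 0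

theorem IsStressSolution.propagate_eq {ξ : ℂ} {Y : ℝ → Fin 4 → ℂ}
    (h : M.IsStressSolution ω ξ Y) : M.propagate ω ξ (Y M.ZI) = Y 0 :=
  (isStressSolution_linearFlow ξ (Y M.ZI)).eqOn_Icc h (linearFlow_init ξ)
    (right_mem_Icc.2 M.ZI_neg.le)

theorem propagate_add (ξ : ℂ) (v w : Fin 4 → ℂ) :
    M.propagate ω ξ (v + w) = M.propagate ω ξ v + M.propagate ω ξ w := by
  have h := ((isStressSolution_linearFlow (M := M) (ω := ω) ξ v).add
    (isStressSolution_linearFlow ξ w)).propagate_eq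
  rwa [linearFlow_init, linearFlow_init] at h

theorem propagate_smul (ξ c : ℂ) (v : Fin 4 → ℂ) :
    M.propagate ω ξ (c • v) = c • M.propagate ω ξ v := by
  have h := ((isStressSolution_linearFlow (M := M) (ω := ω) ξ v).smul c).propagate_eq
  rwa [linearFlow_init] at h

/-- A plane wave below `Z_I`, continued through the slab. -/
theorem linearFlow_eq_planeWave {ξ q : ℂ} {v : Fin 4 → ℂ}
    (hv : ∀ Z ≤ M.ZI, M.stressOp ω Z ξ v = (-(I * q)) • v) {Z : ℝ} (hZ : Z ≤ M.ZI) :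
    linearFlow (M.stressOp ω) M.ZI (exp (-(I * M.ZI * q)) • v) ξ Z = exp (-(I * Z * q)) • v := by
  obtain ⟨K, hK⟩ := IsStressSolution.exists_lipschitz M ω ξ Z M.ZI
  have hd : ∀ t : ℝ, HasDerivAt (fun t : ℝ => exp (-(I * t * q)) • v)
      ((exp (-(I * t * q)) * -(I * q)) • v) t := by
    intro t
    refine HasDerivAt.smul_const ?_ v
    have h1 : HasDerivAt (fun t : ℝ => -(I * (t : ℂ) * q)) (-(I * 1 * q)) t :=
      (((hasDerivAt_id t).ofReal_comp.const_mul I).mul_const q).neg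
    simpa using h1.cexp
  have hY := isStressSolution_linearFlow (M := M) (ω := ω) ξ (exp (-(I * M.ZI * q)) • v)
  -- The flow is prescribed at `Z_I`, so uniqueness is used backwards, into the homogeneous
  -- half-space.
  refine ODE_solution_unique_of_mem_Icc_left (v := fun t y => M.stressOp ω t ξ y)
    (s := fun _ => univ) (a := Z) (b := M.ZI) (fun t ht => hK t (Ioc_subset_Icc_self ht))
    (hY.continuousOn.mono (Icc_subset_Iic_self.trans (Iic_subset_Iic.2 M.ZI_neg.le)))
    (fun t _ => (hasDerivAt_linearFlow (M.continuous_stressOp ω) ξ t).hasDerivWithinAt)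
    (fun _ _ => mem_univ _) (fun t _ => (hd t).continuousAt.continuousWithinAt)
    (fun t ht => ?_) (fun _ _ => mem_univ _) (linearFlow_init ξ) (left_mem_Icc.2 hZ)
  refine ((hd t).congr_deriv ?_).hasDerivWithinAt
  rw [map_smul, hv t ht.2, smul_smul]

theorem exists_planeWave {ξ q : ℂ} {v : Fin 4 → ℂ}
    (hv : ∀ Z ≤ M.ZI, M.stressOp ω Z ξ v = (-(I * q)) • v) :
    ∃ f, M.IsRayleighSolution ω ξ f ∧ (∀ Z < M.ZI, f Z = exp (-(I * Z * q)) • (v 0, v 1)) ∧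
      M.stressVec ξ f 0 = exp (-(I * M.ZI * q)) • M.propagate ω ξ v := by
  have h := isStressSolution_linearFlow (M := M) (ω := ω) ξ (exp (-(I * M.ZI * q)) • v)
  refine ⟨_, h.isRayleighSolution.1, fun Z hZ => ?_, ?_⟩
  · rw [linearFlow_eq_planeWave hv hZ.le]
    rfl
  · rw [h.isRayleighSolution.2 0 le_rfl, ← propagate_smul]
    rfl

/-- The solutions agree near the interior point `Z_I - 1`, hence so do their derivatives and
tractions there, and uniqueness carries this to the surface. This makes the arbitrary choice in
`jostP` and `jostS` harmless. -/
theorem IsRayleighSolution.stressVec_zero_congr {ξ : ℂ} {f g : ℝ → ℂ × ℂ}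
    (hf : M.IsRayleighSolution ω ξ f) (hg : M.IsRayleighSolution ω ξ g)
    (hfg : ∀ Z < M.ZI, f Z = g Z) : M.stressVec ξ f 0 = M.stressVec ξ g 0 := by
  have hlt : M.ZI - 1 < M.ZI := by linarith
  refine hf.isStressSolution.eqOn_Icc hg.isStressSolution (a := M.ZI - 1) ?_
    (right_mem_Icc.2 (by linarith [M.ZI_neg]))
  have he : f =ᶠ[nhdsWithin (M.ZI - 1) (Iic 0)] g :=
    mem_nhdsWithin_of_mem_nhds (eventually_of_mem (Iio_mem_nhds hlt) hfg)
  have e1 : (fun s => (f s).1) =ᶠ[nhdsWithin (M.ZI - 1) (Iic 0)] fun s => (g s).1 :=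
    he.fun_comp Prod.fst
  have e2 : (fun s => (f s).2) =ᶠ[nhdsWithin (M.ZI - 1) (Iic 0)] fun s => (g s).2 :=
    he.fun_comp Prod.snd
  have h0 := hfg _ hlt
  have d1 : dZ (fun s => (f s).1) (M.ZI - 1) = dZ (fun s => (g s).1) (M.ZI - 1) :=
    e1.derivWithin_eq (by rw [h0])
  have d2 : dZ (fun s => (f s).2) (M.ZI - 1) = dZ (fun s => (g s).2) (M.ZI - 1) :=
    e2.derivWithin_eq (by rw [h0])
  simp only [stressVec, tractionA, tractionB, h0, d1, d2]

/-- Displacement and traction of the unperturbed Jost solution `f_{P,0}^-`, up to the exponential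
factor. -/
def pVec (x : M.Surface ω) : Fin 4 → ℂ :=
  ![x.ξ, -x.qP, -(2 * I * x.ξ * M.mu M.ZI * x.qP),
    I * ((ω : ℂ) ^ 2 - 2 * M.mu M.ZI * x.ξ ^ 2)]

/-- Displacement and traction of the unperturbed Jost solution `f_{S,0}^-`, up to the exponential
factor. -/
def sVec (x : M.Surface ω) : Fin 4 → ℂ :=
  ![-x.qS, -x.ξ, I * ((ω : ℂ) ^ 2 - 2 * M.mu M.ZI * x.ξ ^ 2),
    2 * I * x.ξ * M.mu M.ZI * x.qS]

theorem pMod_mul_qP_sq (x : M.Surface ω) :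
    (M.pMod M.ZI : ℂ) * x.qP ^ 2 = (ω : ℂ) ^ 2 - M.pMod M.ZI * x.ξ ^ 2 := by
  have hp := pMod_ne_zero (M := M) M.ZI_neg.le
  rw [x.qP_sq, kP, ← pMod_coe]
  field_simp

theorem mu_mul_qS_sq (x : M.Surface ω) :
    (M.mu M.ZI : ℂ) * x.qS ^ 2 = (ω : ℂ) ^ 2 - M.mu M.ZI * x.ξ ^ 2 := by
  have hp := mu_ne_zero (M := M) M.ZI_neg.le
  rw [x.qS_sq, kS]
  field_simp

/-- The eigenvector identity is the dispersion relation `(λ + 2μ)(q_P² + ξ²) = ω²`, which holds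
wherever the moduli have their limiting values. -/
theorem stressOp_pVec (x : M.Surface ω) {Z : ℝ} (hZ : Z ≤ M.ZI) :
    M.stressOp ω Z x.ξ (pVec x) = (-(I * x.qP)) • pVec x := by
  have hm := mu_ne_zero (M := M) M.ZI_neg.le
  have hp := pMod_ne_zero (M := M) M.ZI_neg.le
  have h := pMod_mul_qP_sq x
  have hl : (M.lam M.ZI : ℂ) = M.pMod M.ZI - 2 * M.mu M.ZI := by rw [pMod_coe]; ring
  have hpm : M.pMod Z = M.pMod M.ZI := by rw [pMod, pMod, M.lam_eq Z hZ, M.mu_eq Z hZ]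
  rw [M.stressOp_apply ω (hZ.trans M.ZI_neg.le), hpm, M.lam_eq Z hZ, M.mu_eq Z hZ, hl, pVec]
  ext i
  fin_cases i <;> simp <;> field_simp
  · ring
  · linear_combination -h
  · ring_nf
    simp only [I_sq]
    linear_combination 2 * x.ξ * M.mu M.ZI * h
  · ring_nf
    simp only [I_sq]
    ring

theorem stressOp_sVec (x : M.Surface ω) {Z : ℝ} (hZ : Z ≤ M.ZI) :
    M.stressOp ω Z x.ξ (sVec x) = (-(I * x.qS)) • sVec x := by
  have hm := mu_ne_zero (M := M) M.ZI_neg.le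
  have hp := pMod_ne_zero (M := M) M.ZI_neg.le
  have h := mu_mul_qS_sq x
  have hl : (M.lam M.ZI : ℂ) = M.pMod M.ZI - 2 * M.mu M.ZI := by rw [pMod_coe]; ring
  have hpm : M.pMod Z = M.pMod M.ZI := by rw [pMod, pMod, M.lam_eq Z hZ, M.mu_eq Z hZ]
  rw [M.stressOp_apply ω (hZ.trans M.ZI_neg.le), hpm, M.lam_eq Z hZ, M.mu_eq Z hZ, hl, sVec]
  ext i
  fin_cases i <;> simp <;> field_simp
  · linear_combination -h
  · ring
  · ring_nf
    simp only [I_sq]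
    ring
  · ring_nf
    simp only [I_sq]
    linear_combination -2 * x.ξ * h

theorem stressVec_jostP (x : M.Surface ω) :
    M.stressVec x.ξ (jostP x) 0 = exp (-(I * M.ZI * x.qP)) • M.propagate ω x.ξ (pVec x) := by
  obtain ⟨f, hf, hf0, hfv⟩ := exists_planeWave fun Z hZ => stressOp_pVec x (Z := Z) hZ
  have hs := Classical.epsilon_spec (p := fun f : ℝ → ℂ × ℂ =>
    M.IsRayleighSolution ω x.ξ f ∧ ∀ Z < M.ZI, f Z = jostP0 x Z) ⟨f, hf, hf0⟩
  rw [← hfv]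
  exact hs.1.stressVec_zero_congr hf fun Z hZ => (hs.2 Z hZ).trans (hf0 Z hZ).symm

theorem stressVec_jostS (x : M.Surface ω) :
    M.stressVec x.ξ (jostS x) 0 = exp (-(I * M.ZI * x.qS)) • M.propagate ω x.ξ (sVec x) := by
  obtain ⟨f, hf, hf0, hfv⟩ := exists_planeWave fun Z hZ => stressOp_sVec x (Z := Z) hZ
  have hs := Classical.epsilon_spec (p := fun f : ℝ → ℂ × ℂ =>
    M.IsRayleighSolution ω x.ξ f ∧ ∀ Z < M.ZI, f Z = jostS0 x Z) ⟨f, hf, hf0⟩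
  rw [← hfv]
  exact hs.1.stressVec_zero_congr hf fun Z hZ => (hs.2 Z hZ).trans (hf0 Z hZ).symm

/-- The Rayleigh determinant without its exponential factor. -/
def reducedDet (x : M.Surface ω) : ℂ :=
  M.propagate ω x.ξ (pVec x) 3 * M.propagate ω x.ξ (sVec x) 2
    - M.propagate ω x.ξ (sVec x) 3 * M.propagate ω x.ξ (pVec x) 2

theorem rayleighDet_eq (x : M.Surface ω) :
    rayleighDet x = exp (-(I * M.ZI * (x.qP + x.qS))) * reducedDet x := by
  have hP := stressVec_jostP x
  have hS := stressVec_jostS x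
  have a1 : M.tractionA x.ξ (jostP x) 0 = _ := congrFun hP 3
  have b1 : M.tractionB x.ξ (jostP x) 0 = _ := congrFun hP 2
  have a2 : M.tractionA x.ξ (jostS x) 0 = _ := congrFun hS 3
  have b2 : M.tractionB x.ξ (jostS x) 0 = _ := congrFun hS 2
  rw [rayleighDet, boundaryMatrix, Matrix.det_fin_two_of, a1, b1, a2, b2, reducedDet,
    show -(I * M.ZI * (x.qP + x.qS)) = -(I * M.ZI * x.qP) + -(I * M.ZI * x.qS) by ring, exp_add]
  simp only [Pi.smul_apply, smul_eq_mul]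
  ring

/-- The four exponents `± q_P ± q_S` add up to zero. -/
theorem rayleighProd_eq (x : M.Surface ω) :
    rayleighProd x =
      reducedDet x * reducedDet x.wP * reducedDet x.wS * reducedDet x.wPS := by
  have h : exp (-(I * M.ZI * (x.qP + x.qS))) * exp (-(I * M.ZI * (-x.qP + x.qS))) *
      exp (-(I * M.ZI * (x.qP + -x.qS))) * exp (-(I * M.ZI * (-x.qP + -x.qS))) = 1 := by
    rw [← exp_add, ← exp_add, ← exp_add]
    ring_nf
    exact exp_zero
  rw [rayleighProd, rayleighDet_eq, rayleighDet_eq, rayleighDet_eq, rayleighDet_eq]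
  change _ * (exp (-(I * M.ZI * (-x.qP + x.qS))) * _) * (exp (-(I * M.ZI * (x.qP + -x.qS))) * _) *
    (exp (-(I * M.ZI * (-x.qP + -x.qS))) * _) = _
  linear_combination (reducedDet x * reducedDet x.wP * reducedDet x.wS * reducedDet x.wPS) * h

/-- The propagator is linear and depends on `ξ` alone; `pVec` is affine in `q_P` and `sVec` in
`q_S`, with coefficients polynomial in `ξ`. The determinant is bilinear in the two. -/
theorem exists_reducedDet_eq (M : ElasticMedium) (ω : ℝ) :
    ∃ a b c d : ℂ → ℂ, Differentiable ℂ a ∧ Differentiable ℂ b ∧ Differentiable ℂ c ∧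
      Differentiable ℂ d ∧ ∀ x : M.Surface ω,
      reducedDet x = a x.ξ + b x.ξ * x.qP + c x.ξ * x.qS + d x.ξ * (x.qP * x.qS) := by
  set D : ℂ → ℂ := fun ξ => I * ((ω : ℂ) ^ 2 - 2 * M.mu M.ZI * ξ ^ 2) with hD
  have hDd : Differentiable ℂ D := by fun_prop
  let p₀ : ℂ → Fin 4 → ℂ := fun ξ => ξ • M.propagate ω ξ (Pi.single 0 1)
    + D ξ • M.propagate ω ξ (Pi.single 3 1)
  let p₁ : ℂ → Fin 4 → ℂ := fun ξ => (-1 : ℂ) • M.propagate ω ξ (Pi.single 1 1)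
    + (-(2 * I * ξ * M.mu M.ZI)) • M.propagate ω ξ (Pi.single 2 1)
  let s₀ : ℂ → Fin 4 → ℂ := fun ξ => (-ξ) • M.propagate ω ξ (Pi.single 1 1)
    + D ξ • M.propagate ω ξ (Pi.single 2 1)
  let s₁ : ℂ → Fin 4 → ℂ := fun ξ => (-1 : ℂ) • M.propagate ω ξ (Pi.single 0 1)
    + (2 * I * ξ * M.mu M.ZI) • M.propagate ω ξ (Pi.single 3 1)
  have hp : ∀ x : M.Surface ω, M.propagate ω x.ξ (pVec x) = p₀ x.ξ + x.qP • p₁ x.ξ := by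
    intro x
    simp only [p₀, p₁, ← propagate_smul, ← propagate_add]
    congr 1
    ext i
    fin_cases i <;> (simp [pVec, hD]; try ring)
  have hs : ∀ x : M.Surface ω, M.propagate ω x.ξ (sVec x) = s₀ x.ξ + x.qS • s₁ x.ξ := by
    intro x
    simp only [s₀, s₁, ← propagate_smul, ← propagate_add]
    congr 1
    ext i
    fin_cases i <;> (simp [sVec, hD]; try ring)
  have hprop : ∀ j, Differentiable ℂ fun ξ => M.propagate ω ξ (Pi.single j 1) := fun j =>
    differentiable_propagate _
  have hlin : ∀ {f g : ℂ → ℂ} (j k : Fin 4), Differentiable ℂ f → Differentiable ℂ g →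
      ∀ i, Differentiable ℂ fun ξ => (f ξ • M.propagate ω ξ (Pi.single j 1)
        + g ξ • M.propagate ω ξ (Pi.single k 1)) i := fun j k hf hg i =>
    differentiable_pi.1 ((hf.smul (hprop j)).add (hg.smul (hprop k))) i
  have dp₀ : ∀ i, Differentiable ℂ fun ξ => p₀ ξ i := hlin 0 3 differentiable_id hDd
  have dp₁ : ∀ i, Differentiable ℂ fun ξ => p₁ ξ i :=
    hlin 1 2 (differentiable_const _) (by fun_prop)
  have ds₀ : ∀ i, Differentiable ℂ fun ξ => s₀ ξ i := hlin 1 2 differentiable_id.neg hDd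
  have ds₁ : ∀ i, Differentiable ℂ fun ξ => s₁ ξ i :=
    hlin 0 3 (differentiable_const _) (by fun_prop)
  refine ⟨fun ξ => p₀ ξ 3 * s₀ ξ 2 - s₀ ξ 3 * p₀ ξ 2, fun ξ => p₁ ξ 3 * s₀ ξ 2 - s₀ ξ 3 * p₁ ξ 2,
    fun ξ => p₀ ξ 3 * s₁ ξ 2 - s₁ ξ 3 * p₀ ξ 2, fun ξ => p₁ ξ 3 * s₁ ξ 2 - s₁ ξ 3 * p₁ ξ 2,
    ((dp₀ 3).mul (ds₀ 2)).sub ((ds₀ 3).mul (dp₀ 2)),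
    ((dp₁ 3).mul (ds₀ 2)).sub ((ds₀ 3).mul (dp₁ 2)),
    ((dp₀ 3).mul (ds₁ 2)).sub ((ds₁ 3).mul (dp₀ 2)),
    ((dp₁ 3).mul (ds₁ 2)).sub ((ds₁ 3).mul (dp₁ 2)), fun x => ?_⟩
  rw [reducedDet, hp, hs]
  simp only [Pi.add_apply, Pi.smul_apply, smul_eq_mul]
  ring

/-- The product over the four sheets is an entire function of `ξ`. -/
theorem differentiable_rayleighF (M : ElasticMedium) (ω : ℝ) :
    Differentiable ℂ (M.rayleighF ω) := by
  obtain ⟨a, b, c, d, ha, hb, hc, hd, h⟩ := exists_reducedDet_eq M ω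
  -- Multiplying over the sign of `q_S` turns `(a + b q_P) + q_S (c + d q_P)` into an expression `U
  -- + 2 q_P V`; multiplying over the sign of `q_P` leaves `U² - 4 q_P² V²`.
  have hF : M.rayleighF ω = fun ξ =>
      (a ξ ^ 2 + b ξ ^ 2 * (M.kP ω - ξ ^ 2)
        - (M.kS ω - ξ ^ 2) * (c ξ ^ 2 + d ξ ^ 2 * (M.kP ω - ξ ^ 2))) ^ 2
      - 4 * (M.kP ω - ξ ^ 2) * (a ξ * b ξ - (M.kS ω - ξ ^ 2) * (c ξ * d ξ)) ^ 2 := by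
    ext ξ
    rw [rayleighF, rayleighProd_eq, h, h, h, h]
    have e1 := (M.physicalPoint ω ξ).qP_sq
    have e2 := (M.physicalPoint ω ξ).qS_sq
    have e3 : (M.physicalPoint ω ξ).ξ = ξ := rfl
    simp only [Surface.wP, Surface.wS, Surface.wPS]
    rw [e3] at e1 e2 ⊢
    rw [← e1, ← e2]
    ring
  rw [hF]
  fun_prop

end ElasticMedium

/-! ### Reduction of the displacement–traction system to Jordan form -/

section Growth

/-- Amplitudes of displacement and traction `y` with respect to a basis of principal vectors of the
leading part of the generator; `m = λ + 2μ`. -/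
def wavePotential (μ m ξ : ℂ) (y : Fin 4 → ℂ) : Fin 4 → ℂ :=
  ![ξ * y 0,
    y 2 * μ⁻¹ / 2 + μ * ((y 2 * μ⁻¹ / 2 - I * ξ * y 1) * m⁻¹),
    (y 2 * μ⁻¹ / 2 - I * ξ * y 1) * m⁻¹,
    (y 3 + 2 * I * ξ * μ * y 0) * (μ⁻¹ * m⁻¹) * (-I / 2)]

theorem exists_norm_wavePotential_le (μ m : ℂ) :
    ∃ C, 0 ≤ C ∧ ∀ (ξ : ℂ) (y : Fin 4 → ℂ), 1 ≤ ‖ξ‖ → ∀ i,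
      ‖wavePotential μ m ξ y i‖ ≤ C * (‖ξ‖ * ‖y‖) := by
  set p := ‖μ⁻¹‖ with hp
  set q := ‖m⁻¹‖ with hq
  set k := (p + 1) * q with hk
  have hp0 : 0 ≤ p := norm_nonneg _
  have hq0 : 0 ≤ q := norm_nonneg _
  have hk0 : 0 ≤ k := by positivity
  have c1 : 0 ≤ ‖μ‖ * k := by positivity
  have c2 : 0 ≤ (1 + 2 * ‖μ‖) * (p * q) := by positivity
  refine ⟨1 + k + (p + ‖μ‖ * k) + (1 + 2 * ‖μ‖) * (p * q), by positivity, fun ξ y hξ => ?_⟩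
  have hy : ∀ i, ‖y i‖ ≤ ‖y‖ := norm_le_pi_norm y
  have hyξ : ∀ i, ‖y i‖ ≤ ‖ξ‖ * ‖y‖ := fun i =>
    (hy i).trans (le_mul_of_one_le_left (norm_nonneg _) hξ)
  have hyξ' : ∀ i, ‖ξ‖ * ‖y i‖ ≤ ‖ξ‖ * ‖y‖ := fun i =>
    mul_le_mul_of_nonneg_left (hy i) (norm_nonneg _)
  generalize ‖ξ‖ * ‖y‖ = N at hyξ hyξ' ⊢
  have hN0 : 0 ≤ N := (norm_nonneg _).trans (hyξ 0)
  have b1 : ‖y 2 * μ⁻¹ / 2‖ ≤ p * N := by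
    rw [norm_div, norm_mul, Complex.norm_ofNat, ← hp]
    have h1 := mul_le_mul_of_nonneg_right (hyξ 2) hp0
    have h2 := mul_nonneg (norm_nonneg (y 2)) hp0
    linarith
  have b2 : ‖(y 2 * μ⁻¹ / 2 - I * ξ * y 1) * m⁻¹‖ ≤ k * N := by
    rw [norm_mul, ← hq]
    have h2 : ‖I * ξ * y 1‖ ≤ N := by
      rw [norm_mul, norm_mul, norm_I, one_mul]
      exact hyξ' 1
    refine (mul_le_mul_of_nonneg_right ((norm_sub_le _ _).trans (add_le_add b1 h2)) hq0).trans_eq ?_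
    rw [hk]; ring
  have b3 : ‖y 2 * μ⁻¹ / 2 + μ * ((y 2 * μ⁻¹ / 2 - I * ξ * y 1) * m⁻¹)‖ ≤ (p + ‖μ‖ * k) * N := by
    have h2 := mul_le_mul_of_nonneg_left b2 (norm_nonneg μ)
    rw [← norm_mul] at h2
    refine (norm_add_le _ _).trans ((add_le_add b1 h2).trans_eq ?_)
    ring
  have b4 : ‖(y 3 + 2 * I * ξ * μ * y 0) * (μ⁻¹ * m⁻¹) * (-I / 2)‖ ≤
      (1 + 2 * ‖μ‖) * (p * q) * N := by
    have h2 : ‖2 * I * ξ * μ * y 0‖ ≤ 2 * ‖μ‖ * N := by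
      simp only [norm_mul, norm_I, Complex.norm_ofNat]
      have := mul_le_mul_of_nonneg_left (hyξ' 0) (norm_nonneg μ)
      linarith
    have h3 : ‖y 3 + 2 * I * ξ * μ * y 0‖ ≤ (1 + 2 * ‖μ‖) * N :=
      (norm_add_le _ _).trans (by linarith [hyξ 3])
    have h4 : ‖-I / 2‖ ≤ 1 := by simp; norm_num
    rw [norm_mul, norm_mul, norm_mul, ← hp, ← hq]
    calc _ ≤ (1 + 2 * ‖μ‖) * N * (p * q) * 1 := by gcongr
      _ = _ := by ring
  intro i
  fin_cases i
  · refine (norm_mul_le ξ (y 0)).trans ((hyξ' 0).trans (le_mul_of_one_le_left hN0 ?_))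
    linarith
  · exact b3.trans (mul_le_mul_of_nonneg_right (by linarith) hN0)
  · exact b2.trans (mul_le_mul_of_nonneg_right (by linarith) hN0)
  · exact b4.trans (mul_le_mul_of_nonneg_right (by linarith) hN0)

/-- Solving for the tractions involves no power of `ξ`: displacements enter the amplitudes already
multiplied by `ξ`, the natural scale of a traction. -/
theorem exists_norm_traction_le_wavePotential {μ m : ℂ} (hμ : μ ≠ 0) (hm : m ≠ 0) :
    ∃ C, 0 ≤ C ∧ ∀ (ξ : ℂ) (y : Fin 4 → ℂ) (X : ℝ), (∀ i, ‖wavePotential μ m ξ y i‖ ≤ X) →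
      ‖y 2‖ ≤ C * X ∧ ‖y 3‖ ≤ C * X := by
  have c1 : 0 ≤ 2 * ‖μ‖ ^ 2 := by positivity
  have c2 : 0 ≤ 2 * ‖μ‖ * ‖m‖ := by positivity
  refine ⟨2 * ‖μ‖ + 2 * ‖μ‖ ^ 2 + 2 * ‖μ‖ * ‖m‖, by positivity, fun ξ y X hX => ?_⟩
  have hX0 : 0 ≤ X := (norm_nonneg _).trans (hX 0)
  have y2 : y 2 = 2 * μ * wavePotential μ m ξ y 1 - 2 * μ ^ 2 * wavePotential μ m ξ y 2 := by
    simp only [wavePotential, Matrix.cons_val]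
    field_simp
    ring
  have y3 : y 3 = 2 * I * μ * m * wavePotential μ m ξ y 3
      - 2 * I * μ * wavePotential μ m ξ y 0 := by
    simp only [wavePotential, Matrix.cons_val]
    field_simp
    ring_nf
    simp only [I_sq, I_pow_three]
    ring
  constructor
  · rw [y2]
    refine (norm_sub_le _ _).trans ?_
    simp only [norm_mul, norm_pow, Complex.norm_ofNat]
    calc _ ≤ 2 * ‖μ‖ * X + 2 * ‖μ‖ ^ 2 * X := by gcongr <;> exact hX _
      _ = (2 * ‖μ‖ + 2 * ‖μ‖ ^ 2) * X := by ring
      _ ≤ _ := mul_le_mul_of_nonneg_right (by linarith) hX0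
  · rw [y3]
    refine (norm_sub_le _ _).trans ?_
    simp only [norm_mul, norm_I, Complex.norm_ofNat, mul_one]
    calc _ ≤ 2 * ‖μ‖ * ‖m‖ * X + 2 * ‖μ‖ * X := by gcongr <;> exact hX _
      _ = (2 * ‖μ‖ + 2 * ‖μ‖ * ‖m‖) * X := by ring
      _ ≤ _ := mul_le_mul_of_nonneg_right (by linarith) hX0

set_option maxHeartbeats 1000000 in
/-- Growth of the amplitudes along the displacement–traction system with `C¹` moduli `μ` and
`m = λ + 2μ`. -/
theorem exists_sum_sq_wavePotential_le {μ m μ' m' : ℝ → ℂ} {a b : ℝ} (hab : a ≤ b) (ω : ℂ)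
    (hμ : ∀ t ∈ Icc a b, HasDerivWithinAt μ (μ' t) (Icc a b) t)
    (hm : ∀ t ∈ Icc a b, HasDerivWithinAt m (m' t) (Icc a b) t)
    (hμ' : ContinuousOn μ' (Icc a b)) (hm' : ContinuousOn m' (Icc a b))
    (hμ0 : ∀ t ∈ Icc a b, μ t ≠ 0) (hm0 : ∀ t ∈ Icc a b, m t ≠ 0) :
    ∃ C, 0 ≤ C ∧ ∀ (ξ : ℂ) (Y : ℝ → Fin 4 → ℂ), 1 ≤ ‖ξ‖ →
      (∀ t ∈ Icc a b, HasDerivWithinAt Y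
        ![(μ t)⁻¹ * Y t 2 - I * ξ * Y t 1,
          (m t)⁻¹ * (Y t 3 - I * ξ * (m t - 2 * μ t) * Y t 0),
          -(I * ξ * (m t - 2 * μ t)) * (m t)⁻¹ * Y t 3
            + (ξ ^ 2 * (4 * μ t * (m t - μ t)) * (m t)⁻¹ - ω ^ 2) * Y t 0,
          -(I * ξ) * Y t 2 - ω ^ 2 * Y t 1] (Icc a b) t) →
      ∑ i, ‖wavePotential (μ b) (m b) ξ (Y b) i‖ ^ 2 ≤
        ‖ξ‖ * (∑ i, ‖wavePotential (μ a) (m a) ξ (Y a) i‖ ^ 2) *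
          Real.exp ((|ξ.re| + C * √‖ξ‖) * (b - a)) ^ 2 := by
  have cμ : ContinuousOn μ (Icc a b) := fun t ht => (hμ t ht).continuousWithinAt
  have cm : ContinuousOn m (Icc a b) := fun t ht => (hm t ht).continuousWithinAt
  -- Remainder of the system for the amplitudes: `R₀` collects the derivatives of the moduli, `R₁`
  -- the terms in `ω²`, which come with a factor `ξ⁻¹`.
  let R₀ : ℝ → Fin 4 → Fin 4 → ℂ := fun t =>
    ![![0, 0, 0, 0],
      ![0, -(μ' t * (μ t)⁻¹) - μ' t * (m t)⁻¹, 2 * μ' t + μ t * μ' t * (m t)⁻¹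
        - μ t * m' t * (m t)⁻¹, 0],
      ![0, -(μ' t * (μ t)⁻¹ * (m t)⁻¹), μ' t * (m t)⁻¹ - m' t * (m t)⁻¹, 0],
      ![μ' t * (μ t)⁻¹ * (m t)⁻¹, 0, 0, -(μ' t * (μ t)⁻¹ + m' t * (m t)⁻¹)]]
  let R₁ : ℝ → Fin 4 → Fin 4 → ℂ := fun t =>
    ![![0, 0, 0, 0],
      ![-(ω ^ 2 * (μ t)⁻¹ / 2) - ω ^ 2 * (m t)⁻¹ / 2, 0, 0, 0],
      ![-(ω ^ 2 * (μ t)⁻¹ * (m t)⁻¹ / 2), 0, 0, 0],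
      ![0, ω ^ 2 * (μ t)⁻¹ * (m t)⁻¹ / 2, -(ω ^ 2 * (m t + μ t) * (μ t)⁻¹ * (m t)⁻¹ / 2), 0]]
  have cR₀ : ContinuousOn R₀ (Icc a b) := by
    refine continuousOn_pi.2 fun i => continuousOn_pi.2 fun j => ?_
    fin_cases i <;> fin_cases j <;> simp [R₀] <;> fun_prop (disch := assumption)
  have cR₁ : ContinuousOn R₁ (Icc a b) := by
    refine continuousOn_pi.2 fun i => continuousOn_pi.2 fun j => ?_
    fin_cases i <;> fin_cases j <;> simp [R₁] <;> fun_prop (disch := assumption)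
  obtain ⟨C₀, hC₀⟩ := isCompact_Icc.exists_bound_of_continuousOn cR₀
  obtain ⟨C₁, hC₁⟩ := isCompact_Icc.exists_bound_of_continuousOn cR₁
  obtain ⟨C₂, hC₂⟩ := isCompact_Icc.exists_bound_of_continuousOn (cm.sub cμ)
  have ha : a ∈ Icc a b := left_mem_Icc.2 hab
  have hb : b ∈ Icc a b := right_mem_Icc.2 hab
  have hC₀0 : 0 ≤ C₀ := (norm_nonneg _).trans (hC₀ a ha)
  have hC₁0 : 0 ≤ C₁ := (norm_nonneg _).trans (hC₁ a ha)
  have hC₂0 : 0 ≤ C₂ := (norm_nonneg _).trans (hC₂ a ha)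
  set C := C₀ + C₁ + C₂ with hC
  have hCnn : 0 ≤ C := by positivity
  -- Half of the 24 in `sum_sq_norm_le_of_jordan`, since the exponential is written as a square
  -- here.
  refine ⟨12 * C, by positivity, fun ξ Y hξ hY => ?_⟩
  have hξ0 : ξ ≠ 0 := by rintro rfl; norm_num at hξ
  have hYi : ∀ t ∈ Icc a b, ∀ i, HasDerivWithinAt (fun s => Y s i) _ (Icc a b) t :=
    fun t ht i => hasDerivWithinAt_pi.1 (hY t ht) i
  let x : Fin 4 → ℝ → ℂ := fun i t => wavePotential (μ t) (m t) ξ (Y t) i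
  let r : Fin 4 → ℝ → ℂ := fun i t => ∑ j, (R₀ t i j + ξ⁻¹ * R₁ t i j) * x j t
  have hμi : ∀ t ∈ Icc a b, HasDerivWithinAt (fun t => (μ t)⁻¹) (-μ' t / μ t ^ 2)
      (Icc a b) t := fun t ht => (hμ t ht).fun_inv (hμ0 t ht)
  have hmi : ∀ t ∈ Icc a b, HasDerivWithinAt (fun t => (m t)⁻¹) (-m' t / m t ^ 2)
      (Icc a b) t := fun t ht => (hm t ht).fun_inv (hm0 t ht)
  have hx2 : ∀ t ∈ Icc a b, HasDerivWithinAt (x 2) (ξ * x 3 t + r 2 t) (Icc a b) t := by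
    intro t ht
    have h1 := hμ0 t ht
    have h2 := hm0 t ht
    refine ((((hYi t ht 2).mul (hμi t ht)).div_const 2).sub
      ((hYi t ht 1).const_mul (I * ξ)) |>.mul (hmi t ht)).congr_deriv ?_
    simp [x, wavePotential, r, Fin.sum_univ_four, R₀, R₁]
    field_simp
    ring_nf
    simp only [I_sq]
    ring
  have hx1 : ∀ t ∈ Icc a b,
      HasDerivWithinAt (x 1) (ξ * (x 0 t + (m t - μ t) * x 3 t) + r 1 t) (Icc a b) t := by
    intro t ht
    have h1 := hμ0 t ht
    have h2 := hm0 t ht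
    refine ((((hYi t ht 2).mul (hμi t ht)).div_const 2).add
      ((hμ t ht).mul (hx2 t ht))).congr_deriv ?_
    simp [x, wavePotential, r, Fin.sum_univ_four, R₀, R₁]
    field_simp
    ring_nf
    simp only [I_sq]
    ring
  have hx0 : ∀ t ∈ Icc a b,
      HasDerivWithinAt (x 0) (ξ * (x 1 t + (m t - μ t) * x 2 t) + r 0 t) (Icc a b) t := by
    intro t ht
    have h1 := hμ0 t ht
    have h2 := hm0 t ht
    refine ((hYi t ht 0).const_mul ξ).congr_deriv ?_
    simp only [x, wavePotential, r, Fin.sum_univ_four, R₀, R₁, Matrix.cons_val]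
    field_simp
    ring
  have hx3 : ∀ t ∈ Icc a b, HasDerivWithinAt (x 3) (ξ * x 2 t + r 3 t) (Icc a b) t := by
    intro t ht
    have h1 := hμ0 t ht
    have h2 := hm0 t ht
    refine ((((hYi t ht 3).add (((hμ t ht).const_mul (2 * I * ξ)).mul (hYi t ht 0))).mul
      ((hμi t ht).mul (hmi t ht))).mul_const (-I / 2)).congr_deriv ?_
    simp [x, wavePotential, r, Fin.sum_univ_four, R₀, R₁]
    field_simp
    ring_nf
    simp only [I_sq, I_pow_three]
    ring
  have hξinv : ‖ξ⁻¹‖ ≤ 1 := by rw [norm_inv]; exact inv_le_one_of_one_le₀ hξ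
  have hr : ∀ i, ∀ t ∈ Icc a b, ‖r i t‖ ≤ C * ∑ j, ‖x j t‖ := by
    intro i t ht
    rw [Finset.mul_sum]
    refine norm_sum_le_of_le _ fun j _ => ?_
    rw [norm_mul]
    refine mul_le_mul_of_nonneg_right ((norm_add_le _ _).trans ?_) (norm_nonneg _)
    have e0 : ‖R₀ t i j‖ ≤ C₀ :=
      ((norm_le_pi_norm (R₀ t i) j).trans (norm_le_pi_norm (R₀ t) i)).trans (hC₀ t ht)
    have e1 : ‖R₁ t i j‖ ≤ C₁ :=
      ((norm_le_pi_norm (R₁ t i) j).trans (norm_le_pi_norm (R₁ t) i)).trans (hC₁ t ht)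
    rw [norm_mul]
    nlinarith [norm_nonneg (R₁ t i j)]
  refine (sum_sq_norm_le_of_jordan hab hξ (κ := fun t => m t - μ t) (C := C)
    (fun t ht => (hC₂ t ht).trans (by linarith)) hr hx0 hx1 hx2 hx3).trans_eq ?_
  rw [← Real.exp_nat_mul]
  congr 2
  push_cast
  ring

/-- Growth of the traction along the displacement–traction system with `C¹` moduli `μ` and
`m = λ + 2μ`. -/
theorem exists_norm_traction_le {μ m μ' m' : ℝ → ℂ} {a b : ℝ} (hab : a ≤ b) (ω : ℂ)
    (hμ : ∀ t ∈ Icc a b, HasDerivWithinAt μ (μ' t) (Icc a b) t)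
    (hm : ∀ t ∈ Icc a b, HasDerivWithinAt m (m' t) (Icc a b) t)
    (hμ' : ContinuousOn μ' (Icc a b)) (hm' : ContinuousOn m' (Icc a b))
    (hμ0 : ∀ t ∈ Icc a b, μ t ≠ 0) (hm0 : ∀ t ∈ Icc a b, m t ≠ 0) :
    ∃ C, 0 ≤ C ∧ ∀ (ξ : ℂ) (Y : ℝ → Fin 4 → ℂ), 1 ≤ ‖ξ‖ →
      (∀ t ∈ Icc a b, HasDerivWithinAt Y
        ![(μ t)⁻¹ * Y t 2 - I * ξ * Y t 1,
          (m t)⁻¹ * (Y t 3 - I * ξ * (m t - 2 * μ t) * Y t 0),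
          -(I * ξ * (m t - 2 * μ t)) * (m t)⁻¹ * Y t 3
            + (ξ ^ 2 * (4 * μ t * (m t - μ t)) * (m t)⁻¹ - ω ^ 2) * Y t 0,
          -(I * ξ) * Y t 2 - ω ^ 2 * Y t 1] (Icc a b) t) →
      ‖Y b 2‖ ≤ C * ‖ξ‖ ^ 2 * ‖Y a‖ * Real.exp ((|ξ.re| + C * √‖ξ‖) * (b - a)) ∧
      ‖Y b 3‖ ≤ C * ‖ξ‖ ^ 2 * ‖Y a‖ * Real.exp ((|ξ.re| + C * √‖ξ‖) * (b - a)) := by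
  obtain ⟨C, hC0, hC⟩ := exists_sum_sq_wavePotential_le hab ω hμ hm hμ' hm' hμ0 hm0
  obtain ⟨c, hc0, hc⟩ := exists_norm_wavePotential_le (μ a) (m a)
  obtain ⟨d, hd0, hd⟩ := exists_norm_traction_le_wavePotential (hμ0 b (right_mem_Icc.2 hab))
    (hm0 b (right_mem_Icc.2 hab))
  refine ⟨C + d * (2 * c), by positivity, fun ξ Y hξ hY => ?_⟩
  have key := hC ξ Y hξ hY
  set E := Real.exp ((|ξ.re| + C * √‖ξ‖) * (b - a)) with hE
  have hE0 : 0 < E := Real.exp_pos _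
  have hxb : ∀ i, ‖wavePotential (μ b) (m b) ξ (Y b) i‖ ≤
      2 * c * ‖ξ‖ * (‖ξ‖ * ‖Y a‖) * E := by
    intro i
    refine (sq_le_sq₀ (norm_nonneg _) (by positivity)).1 ?_
    calc ‖wavePotential (μ b) (m b) ξ (Y b) i‖ ^ 2
        ≤ ∑ j, ‖wavePotential (μ b) (m b) ξ (Y b) j‖ ^ 2 :=
          Finset.single_le_sum (f := fun j => ‖wavePotential (μ b) (m b) ξ (Y b) j‖ ^ 2)
            (fun j _ => sq_nonneg _) (Finset.mem_univ i)
      _ ≤ ‖ξ‖ * (∑ j, ‖wavePotential (μ a) (m a) ξ (Y a) j‖ ^ 2) * E ^ 2 := key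
      -- One more factor `‖ξ‖ ≥ 1` makes the right-hand side a perfect square; the four equal
      -- summands give the factor 2.
      _ ≤ ‖ξ‖ ^ 2 * (∑ _j : Fin 4, (c * (‖ξ‖ * ‖Y a‖)) ^ 2) * E ^ 2 := by
          gcongr with j
          · nlinarith
          · exact hc ξ (Y a) hξ j
      _ = _ := by simp; ring
  have hEle : E ≤ Real.exp ((|ξ.re| + (C + d * (2 * c)) * √‖ξ‖) * (b - a)) := by
    refine Real.exp_le_exp.2 (mul_le_mul_of_nonneg_right ?_ (sub_nonneg.2 hab))
    have : 0 ≤ d * (2 * c) * √‖ξ‖ := by positivity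
    linarith
  have hfin : d * (2 * c * ‖ξ‖ * (‖ξ‖ * ‖Y a‖) * E) ≤ (C + d * (2 * c)) * ‖ξ‖ ^ 2 * ‖Y a‖ *
      Real.exp ((|ξ.re| + (C + d * (2 * c)) * √‖ξ‖) * (b - a)) := by
    calc _ = d * (2 * c) * ‖ξ‖ ^ 2 * ‖Y a‖ * E := by ring
      _ ≤ _ := by gcongr; linarith
  obtain ⟨h2, h3⟩ := hd ξ (Y b) _ hxb
  exact ⟨h2.trans hfin, h3.trans hfin⟩

end Growth

/-! ### Growth of `F` and its value at the origin -/

namespace ElasticMedium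

variable {M : ElasticMedium} {ω : ℝ}

theorem exists_norm_propagate_le (M : ElasticMedium) (ω : ℝ) :
    ∃ C, 0 ≤ C ∧ ∀ (ξ : ℂ) (v : Fin 4 → ℂ), 1 ≤ ‖ξ‖ →
      ‖M.propagate ω ξ v 2‖ ≤
        C * ‖ξ‖ ^ 2 * ‖v‖ * Real.exp ((|ξ.re| + C * √‖ξ‖) * M.H) ∧
      ‖M.propagate ω ξ v 3‖ ≤
        C * ‖ξ‖ ^ 2 * ‖v‖ * Real.exp ((|ξ.re| + C * √‖ξ‖) * M.H) := by
  have hsub : Icc M.ZI 0 ⊆ Iic 0 := Icc_subset_Iic_self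
  have hm := contDiffOn_ofReal_mu M
  have hp : ContDiffOn ℝ 1 (fun t => (M.pMod t : ℂ)) (Iic 0) := by
    simp only [pMod_coe]
    exact (contDiffOn_ofReal_lam M).add (contDiffOn_const.mul hm)
  have hcont : ∀ {f : ℝ → ℂ}, ContDiffOn ℝ 1 f (Iic 0) → ContinuousOn (dZ f) (Icc M.ZI 0) :=
    fun hf => (hf.continuousOn_derivWithin (uniqueDiffOn_Iic 0) le_rfl).mono hsub
  have hder : ∀ {f : ℝ → ℂ}, ContDiffOn ℝ 1 f (Iic 0) → ∀ t ∈ Icc M.ZI 0,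
      HasDerivWithinAt f (dZ f t) (Icc M.ZI 0) t := fun hf t ht =>
    (hf.hasDerivWithinAt_dZ one_ne_zero ht.2).mono hsub
  obtain ⟨C, hC0, hC⟩ := exists_norm_traction_le M.ZI_neg.le (ω : ℂ) (hder hm) (hder hp)
    (hcont hm) (hcont hp) (fun t ht => mu_ne_zero ht.2) (fun t ht => pMod_ne_zero ht.2)
  refine ⟨C, hC0, fun ξ v hξ => ?_⟩
  have h := hC ξ (linearFlow (M.stressOp ω) M.ZI v ξ) hξ fun t ht => by
    refine ((isStressSolution_linearFlow ξ v t ht.2).mono hsub).congr_deriv ?_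
    rw [M.stressOp_apply ω ht.2]
    have hl : (M.lam t : ℂ) = M.pMod t - 2 * M.mu t := by rw [pMod_coe]; ring
    rw [hl, show (M.pMod t : ℂ) - 2 * M.mu t + M.mu t = M.pMod t - M.mu t by ring]
  rwa [linearFlow_init, zero_sub] at h

theorem norm_le_of_sq_eq_sub_sq {q k ξ : ℂ} (h : q ^ 2 = k - ξ ^ 2) (hξ : 1 ≤ ‖ξ‖) :
    ‖q‖ ≤ (‖k‖ + 1) * ‖ξ‖ := by
  refine (sq_le_sq₀ (norm_nonneg _) (by positivity)).1 ?_
  calc ‖q‖ ^ 2 = ‖k - ξ ^ 2‖ := by rw [← h, norm_pow]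
    _ ≤ ‖k‖ + ‖ξ‖ ^ 2 := (norm_sub_le _ _).trans_eq (by rw [norm_pow])
    _ ≤ (‖k‖ + 1) * ‖ξ‖ ^ 2 := by
      have h1 : 1 ≤ ‖ξ‖ ^ 2 := one_le_pow₀ hξ
      linarith [le_mul_of_one_le_right (norm_nonneg k) h1]
    _ ≤ ((‖k‖ + 1) * ‖ξ‖) ^ 2 := by
      rw [mul_pow]
      refine mul_le_mul_of_nonneg_right ?_ (sq_nonneg _)
      nlinarith [norm_nonneg k]

theorem exists_norm_vec_le (M : ElasticMedium) (ω : ℝ) :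
    ∃ C, 0 ≤ C ∧ ∀ x : M.Surface ω, 1 ≤ ‖x.ξ‖ →
      ‖pVec x‖ ≤ C * ‖x.ξ‖ ^ 2 ∧ ‖sVec x‖ ≤ C * ‖x.ξ‖ ^ 2 := by
  set k := (‖M.kP ω‖ + 1) + (‖M.kS ω‖ + 1) with hk
  have hk0 : 0 ≤ k := by positivity
  set n := ‖(M.mu M.ZI : ℂ)‖ with hn
  have hn0 : 0 ≤ n := norm_nonneg _
  set C := 1 + k + 2 * n * k + (‖(ω : ℂ)‖ ^ 2 + 2 * n) with hC
  have hω : 0 ≤ ‖(ω : ℂ)‖ ^ 2 := by positivity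
  have hnk : 0 ≤ 2 * n * k := by positivity
  refine ⟨C, by positivity, fun x hξ => ?_⟩
  have h1 : ‖x.ξ‖ ≤ ‖x.ξ‖ ^ 2 := by nlinarith
  have h0 : 0 ≤ ‖x.ξ‖ ^ 2 := sq_nonneg _
  have hqP : ‖x.qP‖ ≤ k * ‖x.ξ‖ := (norm_le_of_sq_eq_sub_sq x.qP_sq hξ).trans
    (mul_le_mul_of_nonneg_right (by rw [hk]; linarith [norm_nonneg (M.kS ω)]) (norm_nonneg _))
  have hqS : ‖x.qS‖ ≤ k * ‖x.ξ‖ := (norm_le_of_sq_eq_sub_sq x.qS_sq hξ).trans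
    (mul_le_mul_of_nonneg_right (by rw [hk]; linarith [norm_nonneg (M.kP ω)]) (norm_nonneg _))
  have hD : ‖I * ((ω : ℂ) ^ 2 - 2 * M.mu M.ZI * x.ξ ^ 2)‖ ≤ C * ‖x.ξ‖ ^ 2 := by
    rw [norm_mul, norm_I, one_mul]
    refine (norm_sub_le _ _).trans ?_
    simp only [norm_mul, norm_pow, Complex.norm_ofNat, ← hn]
    calc _ ≤ ‖(ω : ℂ)‖ ^ 2 * ‖x.ξ‖ ^ 2 + 2 * n * ‖x.ξ‖ ^ 2 := by
          gcongr
          exact le_mul_of_one_le_right hω (h1.trans' hξ)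
      _ = (‖(ω : ℂ)‖ ^ 2 + 2 * n) * ‖x.ξ‖ ^ 2 := by ring
      _ ≤ _ := mul_le_mul_of_nonneg_right (by rw [hC]; linarith) h0
  have hq : ∀ q : ℂ, ‖q‖ ≤ k * ‖x.ξ‖ → ‖q‖ ≤ C * ‖x.ξ‖ ^ 2 := fun q hq =>
    hq.trans ((mul_le_mul_of_nonneg_left h1 hk0).trans
      (mul_le_mul_of_nonneg_right (by rw [hC]; linarith) h0))
  have hqq : ∀ q : ℂ, ‖q‖ ≤ k * ‖x.ξ‖ → ‖2 * I * x.ξ * M.mu M.ZI * q‖ ≤ C * ‖x.ξ‖ ^ 2 := by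
    intro q hq
    simp only [norm_mul, norm_I, Complex.norm_ofNat, ← hn, mul_one]
    calc _ ≤ 2 * ‖x.ξ‖ * n * (k * ‖x.ξ‖) := by gcongr
      _ = 2 * n * k * ‖x.ξ‖ ^ 2 := by ring
      _ ≤ _ := mul_le_mul_of_nonneg_right (by rw [hC]; linarith) h0
  have hξ' : ‖x.ξ‖ ≤ C * ‖x.ξ‖ ^ 2 :=
    h1.trans (le_mul_of_one_le_left h0 (by rw [hC]; linarith))
  constructor
  · refine (pi_norm_le_iff_of_nonneg (by positivity)).2 fun i => ?_
    fin_cases i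
    · exact hξ'
    · exact (norm_neg _).trans_le (hq _ hqP)
    · exact (norm_neg _).trans_le (hqq _ hqP)
    · exact hD
  · refine (pi_norm_le_iff_of_nonneg (by positivity)).2 fun i => ?_
    fin_cases i
    · exact (norm_neg _).trans_le (hq _ hqS)
    · exact (norm_neg _).trans_le hξ'
    · exact hD
    · exact hqq _ hqS

theorem H_pos (M : ElasticMedium) : 0 < M.H := neg_pos.2 M.ZI_neg

/-- Each entry carries `‖ξ‖²` from the propagator, `‖ξ‖²` from the initial vector and one
exponential; each term of the determinant has two entries. -/
theorem exists_norm_reducedDet_le (M : ElasticMedium) (ω : ℝ) :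
    ∃ C, 0 ≤ C ∧ ∀ x : M.Surface ω, 1 ≤ ‖x.ξ‖ →
      ‖reducedDet x‖ ≤ C * ‖x.ξ‖ ^ 8 * Real.exp ((|x.ξ.re| + C * √‖x.ξ‖) * M.H) ^ 2 := by
  obtain ⟨C, hC0, hC⟩ := exists_norm_propagate_le M ω
  obtain ⟨c, hc0, hc⟩ := exists_norm_vec_le M ω
  refine ⟨C + 2 * (C * c) ^ 2, by positivity, fun x hξ => ?_⟩
  obtain ⟨hp, hs⟩ := hc x hξ
  obtain ⟨p2, p3⟩ := hC x.ξ (pVec x) hξ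
  obtain ⟨s2, s3⟩ := hC x.ξ (sVec x) hξ
  set E := Real.exp ((|x.ξ.re| + C * √‖x.ξ‖) * M.H) with hE
  have hE0 : 0 < E := Real.exp_pos _
  have bd : ∀ {y V : ℝ}, y ≤ C * ‖x.ξ‖ ^ 2 * V * E → V ≤ c * ‖x.ξ‖ ^ 2 →
      y ≤ C * c * ‖x.ξ‖ ^ 4 * E := fun {y V} hy hV => by
    calc y ≤ C * ‖x.ξ‖ ^ 2 * V * E := hy
      _ ≤ C * ‖x.ξ‖ ^ 2 * (c * ‖x.ξ‖ ^ 2) * E := by gcongr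
      _ = _ := by ring
  have hEle : E ≤ Real.exp ((|x.ξ.re| + (C + 2 * (C * c) ^ 2) * √‖x.ξ‖) * M.H) := by
    refine Real.exp_le_exp.2 (mul_le_mul_of_nonneg_right ?_ M.H_pos.le)
    have : 0 ≤ 2 * (C * c) ^ 2 * √‖x.ξ‖ := by positivity
    linarith
  rw [reducedDet]
  refine (norm_sub_le _ _).trans ?_
  rw [norm_mul, norm_mul]
  calc _ ≤ (C * c * ‖x.ξ‖ ^ 4 * E) * (C * c * ‖x.ξ‖ ^ 4 * E)
        + (C * c * ‖x.ξ‖ ^ 4 * E) * (C * c * ‖x.ξ‖ ^ 4 * E) := by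
        gcongr
        · exact bd p3 hp
        · exact bd s2 hs
        · exact bd s3 hs
        · exact bd p2 hp
    _ = 2 * (C * c) ^ 2 * ‖x.ξ‖ ^ 8 * E ^ 2 := by ring
    _ ≤ _ := by gcongr; linarith

/-- Growth of `F`: exponential type `8 H` in the real directions and only `exp (C √|ξ|)` in the
imaginary ones. -/
theorem exists_norm_rayleighF_le (M : ElasticMedium) (ω : ℝ) :
    ∃ C, 0 < C ∧ ∀ ξ : ℂ,
      ‖M.rayleighF ω ξ‖ ≤ C * Real.exp (8 * M.H * |ξ.re| + C * √‖ξ‖) := by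
  obtain ⟨C, hC0, hC⟩ := exists_norm_reducedDet_le M ω
  obtain ⟨B, hB⟩ := (isCompact_closedBall (0 : ℂ) 1).exists_bound_of_continuousOn
    (differentiable_rayleighF M ω).continuous.continuousOn
  have hB0 : 0 ≤ B := (norm_nonneg _).trans (hB 0 (by simp))
  have hH := M.H_pos
  set K := 1 + B + C ^ 4 * Nat.factorial 64 + 8 * M.H * C with hK
  have p1 : 0 ≤ C ^ 4 * Nat.factorial 64 := by positivity
  have p2 : 0 ≤ 8 * M.H * C := by positivity
  have hK0 : 0 < K := by positivity
  refine ⟨K, hK0, fun ξ => ?_⟩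
  rcases le_total ‖ξ‖ 1 with h | hξ
  · refine (hB ξ (by simpa using h)).trans ?_
    have : 1 ≤ Real.exp (8 * M.H * |ξ.re| + K * √‖ξ‖) := Real.one_le_exp (by positivity)
    exact (le_mul_of_one_le_right hB0 this).trans
      (mul_le_mul_of_nonneg_right (by rw [hK]; linarith) (Real.exp_pos _).le)
  · set x := M.physicalPoint ω ξ with hx
    set T := C * ‖ξ‖ ^ 8 * Real.exp ((|ξ.re| + C * √‖ξ‖) * M.H) ^ 2 with hT
    have b : ∀ y : M.Surface ω, y.ξ = ξ → ‖reducedDet y‖ ≤ T := by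
      rintro y rfl
      exact hC y hξ
    have hprod : ‖M.rayleighF ω ξ‖ ≤ T * T * T * T := by
      rw [rayleighF, rayleighProd_eq, norm_mul, norm_mul, norm_mul]
      gcongr
      · exact b _ rfl
      · exact b _ rfl
      · exact b _ rfl
      · exact b _ rfl
    -- The four factors `‖ξ‖ ^ 8` are absorbed by the term of order 64 in the series of `exp √‖ξ‖`.
    have hpow : ‖ξ‖ ^ 32 ≤ Nat.factorial 64 * Real.exp √‖ξ‖ := by
      have h1 := Real.pow_div_factorial_le_exp (√‖ξ‖) (Real.sqrt_nonneg _) 64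
      have h2 : √‖ξ‖ ^ 64 = ‖ξ‖ ^ 32 := by
        rw [show (64 : ℕ) = 2 * 32 by norm_num, pow_mul, Real.sq_sqrt (norm_nonneg _)]
      rw [h2, div_le_iff₀ (by positivity)] at h1
      linarith
    calc ‖M.rayleighF ω ξ‖ ≤ T * T * T * T := hprod
      _ = C ^ 4 * ‖ξ‖ ^ 32 * Real.exp ((|ξ.re| + C * √‖ξ‖) * M.H) ^ 8 := by rw [hT]; ring
      _ ≤ C ^ 4 * (Nat.factorial 64 * Real.exp √‖ξ‖) *
          Real.exp ((|ξ.re| + C * √‖ξ‖) * M.H) ^ 8 := by gcongr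
      _ = C ^ 4 * Nat.factorial 64 *
          Real.exp (8 * M.H * |ξ.re| + (1 + 8 * M.H * C) * √‖ξ‖) := by
        rw [← Real.exp_nat_mul, ← mul_assoc, mul_assoc, ← Real.exp_add]
        congr 2
        push_cast
        ring
      _ ≤ _ := by
        gcongr
        · rw [hK]; linarith
        · rw [hK]; linarith

/-- The Wronskian of a solution of a real Sturm–Liouville system and its conjugate is constant. -/
theorem _root_.wronskian_conj_eq {f g : ℝ → ℂ} {c : ℝ → ℝ} {w a b : ℝ} (hab : a ≤ b)
    (hf : ∀ t ∈ Icc a b, HasDerivAt f (c t * g t) t)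
    (hg : ∀ t ∈ Icc a b, HasDerivAt g (-(w * f t)) t) :
    (f b * star (g b)) - star (f b) * g b = f a * star (g a) - star (f a) * g a := by
  have hd : ∀ t ∈ Icc a b, HasDerivAt (fun t => f t * star (g t) - star (f t) * g t) 0 t := by
    intro t ht
    refine (((hf t ht).mul (hg t ht).star).sub ((hf t ht).star.mul (hg t ht))).congr_deriv ?_
    simp
    ring
  exact constant_of_has_deriv_right_zero (fun t ht => (hd t ht).continuousAt.continuousWithinAt)
    (fun t ht => (hd t (Ico_subset_Icc_self ht)).hasDerivWithinAt) b (right_mem_Icc.2 hab)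

/-- If the sum vanished, `q` would be purely imaginary and `r q²` could not be positive. -/
theorem add_star_ne_zero_of_sq {q : ℂ} {r w : ℝ} (hr : 0 < r) (hw : 0 < w)
    (h : (r : ℂ) * q ^ 2 = w) : q + star q ≠ 0 := by
  intro h0
  have hre : q.re = 0 := by
    have := congrArg Complex.re h0
    simp at this
    linarith
  have := congrArg Complex.re h
  rw [sq] at this
  simp [hre] at this
  nlinarith [mul_self_nonneg q.im]

/-- At `ξ = 0` the P wave is purely vertical and the S wave purely horizontal, so only a product of
two tractions survives. If one of them vanished at the surface, so would its conserved Wronskian,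
whose value at `Z_I` is a nonzero multiple of `q + star q`. -/
theorem reducedDet_ne_zero_of_ξ_eq_zero (hω : ω ≠ 0) (x : M.Surface ω) (hx : x.ξ = 0) :
    reducedDet x ≠ 0 := by
  have hm : 0 < M.pMod M.ZI := M.lam_add_two_mu_pos _ M.ZI_neg.le
  have hμ := M.mu_pos _ M.ZI_neg.le
  have hω2 : 0 < ω ^ 2 := by positivity
  have hωc : (ω : ℂ) ≠ 0 := by exact_mod_cast hω
  have hflow : ∀ (v : Fin 4 → ℂ) (t : ℝ) (_ : t ≤ 0) (i : Fin 4),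
      HasDerivAt (fun s => linearFlow (M.stressOp ω) M.ZI v 0 s i)
        (M.stressOp ω t 0 (linearFlow (M.stressOp ω) M.ZI v 0 t) i) t := fun v t _ i =>
    hasDerivAt_pi.1 (hasDerivAt_linearFlow (M.continuous_stressOp ω) 0 t) i
  have hinit : ∀ v : Fin 4 → ℂ, linearFlow (M.stressOp ω) M.ZI v 0 M.ZI = v := fun v =>
    linearFlow_init 0
  have hb : M.propagate ω 0 (pVec x) 2 = 0 := by
    have h := isStressSolution_linearFlow (M := M) (ω := ω) 0 (pVec x)
    -- Discarding the horizontal components leaves a solution with the same initial value, so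
    -- uniqueness shows that they vanish.
    have h' : M.IsStressSolution ω 0 fun t => ![0, linearFlow (M.stressOp ω) M.ZI (pVec x) 0 t 1,
        0, linearFlow (M.stressOp ω) M.ZI (pVec x) 0 t 3] := by
      intro t ht
      rw [hasDerivWithinAt_pi, M.stressOp_apply ω ht]
      have hd := hflow (pVec x) t ht
      simp only [M.stressOp_apply ω ht] at hd
      intro i
      fin_cases i
      · simpa using hasDerivWithinAt_const t (Iic 0) (0 : ℂ)
      · simpa using (hd 1).hasDerivWithinAt
      · simpa using hasDerivWithinAt_const t (Iic 0) (0 : ℂ)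
      · simpa using (hd 3).hasDerivWithinAt
    have heq := h.eqOn_Icc h' (a := M.ZI) (by
      rw [hinit]
      ext i
      fin_cases i <;> simp [pVec, hx]) (right_mem_Icc.2 M.ZI_neg.le)
    exact congrFun heq 2
  have ha : M.propagate ω 0 (pVec x) 3 ≠ 0 := by
    intro h0
    have hW := wronskian_conj_eq (c := fun t => (M.pMod t)⁻¹) (w := ω ^ 2) M.ZI_neg.le
      (f := fun t => linearFlow (M.stressOp ω) M.ZI (pVec x) 0 t 1)
      (g := fun t => linearFlow (M.stressOp ω) M.ZI (pVec x) 0 t 3)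
      (fun t ht => by simpa [M.stressOp_apply ω ht.2] using hflow (pVec x) t ht.2 1)
      (fun t ht => by simpa [M.stressOp_apply ω ht.2] using hflow (pVec x) t ht.2 3)
    have h0' : linearFlow (M.stressOp ω) M.ZI (pVec x) 0 0 3 = 0 := h0
    simp only [hinit, h0', star_zero, mul_zero, sub_zero] at hW
    simp [pVec, hx] at hW
    refine add_star_ne_zero_of_sq (q := x.qP) hm hω2 ?_ ?_
    · simpa [hx] using pMod_mul_qP_sq x
    · have : I * (ω : ℂ) ^ 2 * (x.qP + star x.qP) = 0 := by
        simp only [star_def]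
        linear_combination -hW
      simpa [hωc] using this
  have hbS : M.propagate ω 0 (sVec x) 2 ≠ 0 := by
    intro h0
    have hW := wronskian_conj_eq (c := fun t => (M.mu t)⁻¹) (w := ω ^ 2) M.ZI_neg.le
      (f := fun t => linearFlow (M.stressOp ω) M.ZI (sVec x) 0 t 0)
      (g := fun t => linearFlow (M.stressOp ω) M.ZI (sVec x) 0 t 2)
      (fun t ht => by simpa [M.stressOp_apply ω ht.2] using hflow (sVec x) t ht.2 0)
      (fun t ht => by simpa [M.stressOp_apply ω ht.2] using hflow (sVec x) t ht.2 2)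
    have h0' : linearFlow (M.stressOp ω) M.ZI (sVec x) 0 0 2 = 0 := h0
    simp only [hinit, h0', star_zero, mul_zero, sub_zero] at hW
    simp [sVec, hx] at hW
    refine add_star_ne_zero_of_sq (q := x.qS) hμ hω2 ?_ ?_
    · simpa [hx] using mu_mul_qS_sq x
    · have : I * (ω : ℂ) ^ 2 * (x.qS + star x.qS) = 0 := by
        simp only [star_def]
        linear_combination -hW
      simpa [hωc] using this
  rw [reducedDet, hx, hb, mul_zero, sub_zero]
  exact mul_ne_zero ha hbS

theorem rayleighF_zero_ne_zero (hω : ω ≠ 0) : M.rayleighF ω 0 ≠ 0 := by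
  rw [rayleighF, rayleighProd_eq]
  refine mul_ne_zero (mul_ne_zero (mul_ne_zero ?_ ?_) ?_) ?_ <;>
    exact reducedDet_ne_zero_of_ξ_eq_zero hω _ rfl

end ElasticMedium

/-! ### Indices of entire functions of exponential type -/

section ExponentialType

/-- `f` decays faster than every exponential along the ray through `u`. -/
def DecaysAlong (f : ℂ → ℂ) (u : ℂ) : Prop :=
  ∀ N : ℝ, ∃ B : ℝ, ∀ x : ℝ, 0 ≤ x → ‖f (x * u)‖ ≤ B * Real.exp (-(N * x))

theorem isBigO_exp_of_norm_le {f : ℂ → ℂ} {C α : ℝ} (hf : ∀ z, ‖f z‖ ≤ C * Real.exp (α * ‖z‖))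
    (l : Filter ℂ) :
    ∃ c < (2 : ℝ), ∃ B, f =O[l] fun z => Real.exp (B * ‖z‖ ^ c) := by
  refine ⟨1, one_lt_two, α, Asymptotics.IsBigO.of_bound C (Eventually.of_forall fun z => ?_)⟩
  rw [Real.norm_of_nonneg (Real.exp_pos _).le, Real.rpow_one]
  exact hf z

theorem IsExponentialType.exists_nonneg {f : ℂ → ℂ} (hf : IsExponentialType f) :
    ∃ C α : ℝ, 0 ≤ C ∧ 0 ≤ α ∧ ∀ z : ℂ, ‖f z‖ ≤ C * Real.exp (α * ‖z‖) := by
  obtain ⟨C, α, h⟩ := hf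
  have hC : 0 ≤ C := by
    have := (norm_nonneg _).trans (h 0)
    simpa using this
  refine ⟨C, max α 0, hC, le_max_right _ _, fun z => (h z).trans ?_⟩
  gcongr
  exact le_max_left _ _

theorem IsExponentialType.comp_const_mul {f : ℂ → ℂ} (hf : IsExponentialType f) (u : ℂ) :
    IsExponentialType fun z => f (u * z) := by
  obtain ⟨C, α, h⟩ := hf
  refine ⟨C, α * ‖u‖, fun z => (h _).trans_eq ?_⟩
  rw [norm_mul, mul_assoc]

/-- Phragmén–Lindelöf in the first quadrant passes the decay on the real half-axis to the bisector;
on the imaginary half-axis the exponential type is enough. -/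
theorem DecaysAlong.one_add_I {f : ℂ → ℂ} (hd : Differentiable ℂ f) (hf : IsExponentialType f)
    (h : DecaysAlong f 1) : DecaysAlong f (1 + I) := by
  obtain ⟨C, α, hC, hα, hfb⟩ := hf.exists_nonneg
  intro N
  set n := α + max N 0 with hn
  have hn0 : 0 ≤ n := add_nonneg hα (le_max_right _ _)
  obtain ⟨B, hB⟩ := h n
  have hre : ∀ z : ℂ, (((n : ℂ) + α * I) * z).re = n * z.re - α * z.im := by intro z; simp
  -- The multiplier has modulus `e^{nx}` on the real axis, offset by the decay of `f`, and `e^{-αy}`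
  -- on the imaginary axis, offsetting its growth. On the bisector it gains `e^{(n - α)x}`, hence `n
  -- = α + max N 0`.
  set G : ℂ → ℂ := fun z => f z * exp (((n : ℂ) + α * I) * z) with hG
  have hGd : Differentiable ℂ G := hd.mul (by fun_prop)
  have hGn : ∀ z, ‖G z‖ = ‖f z‖ * Real.exp (n * z.re - α * z.im) := by
    intro z
    rw [hG, norm_mul, norm_exp, hre]
  have hGb : ∀ z, ‖G z‖ ≤ C * Real.exp ((α + (n + α)) * ‖z‖) := by
    intro z
    rw [hGn, add_mul α (n + α), Real.exp_add, ← mul_assoc]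
    refine mul_le_mul (hfb z) (Real.exp_le_exp.2 ?_) (Real.exp_pos _).le (by positivity)
    have h1 := mul_le_mul_of_nonneg_left ((le_abs_self _).trans (abs_re_le_norm z)) hn0
    have h2 := mul_le_mul_of_nonneg_left ((neg_le_abs _).trans (abs_im_le_norm z)) hα
    linarith
  have hGre : ∀ x : ℝ, 0 ≤ x → ‖G x‖ ≤ max B C := by
    intro x hx
    rw [hGn]
    refine le_trans ?_ (le_max_left _ _)
    have := mul_le_mul_of_nonneg_right (hB x hx) (Real.exp_pos (n * x)).le
    rw [mul_assoc, ← Real.exp_add] at this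
    simpa using this
  have hGim : ∀ x : ℝ, 0 ≤ x → ‖G (x * I)‖ ≤ max B C := by
    intro x hx
    rw [hGn]
    refine le_trans ?_ (le_max_right _ _)
    have := mul_le_mul_of_nonneg_right (hfb (x * I)) (Real.exp_pos (-(α * x))).le
    rw [mul_assoc, ← Real.exp_add] at this
    simpa [abs_of_nonneg hx] using this
  refine ⟨max B C, fun x hx => ?_⟩
  have key := PhragmenLindelof.quadrant_I (z := x * (1 + I)) hGd.diffContOnCl
    (isBigO_exp_of_norm_le hGb _) hGre hGim (by simpa using hx) (by simpa using hx)
  rw [hGn] at key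
  have h1 : n * ((x : ℂ) * (1 + I)).re - α * ((x : ℂ) * (1 + I)).im = max N 0 * x := by
    simp [hn]; ring
  rw [h1] at key
  have hM : 0 ≤ max B C := hC.trans (le_max_right _ _)
  calc ‖f (x * (1 + I))‖
      = ‖f (x * (1 + I))‖ * Real.exp (max N 0 * x) * Real.exp (-(max N 0 * x)) := by
        rw [mul_assoc, ← Real.exp_add]; simp
    _ ≤ max B C * Real.exp (-(N * x)) := by
        refine mul_le_mul key (Real.exp_le_exp.2 ?_) (Real.exp_pos _).le hM
        have := mul_le_mul_of_nonneg_right (le_max_left N 0) hx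
        linarith

theorem DecaysAlong.mul_one_add_I {f : ℂ → ℂ} (hd : Differentiable ℂ f)
    (hf : IsExponentialType f) {u : ℂ} (h : DecaysAlong f u) : DecaysAlong f (u * (1 + I)) := by
  have h' : DecaysAlong (fun z => f (u * z)) 1 := fun N => by
    obtain ⟨B, hB⟩ := h N
    exact ⟨B, fun x hx => by simpa [mul_comm] using hB x hx⟩
  intro N
  obtain ⟨B, hB⟩ := h'.one_add_I (hd.comp (by fun_prop)) (hf.comp_const_mul u) N
  refine ⟨B, fun x hx => ?_⟩
  rw [show (x : ℂ) * (u * (1 + I)) = u * (x * (1 + I)) by ring]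
  exact hB x hx

theorem DecaysAlong.exists_bound {f : ℂ → ℂ} {u : ℂ} (h : DecaysAlong f u) {r : ℝ} (hr : 0 < r)
    {v : ℂ} (huv : u = r * v) : ∃ B, ∀ x : ℝ, 0 ≤ x → ‖f (x * v)‖ ≤ B := by
  obtain ⟨B, hB⟩ := h 0
  refine ⟨B, fun x hx => ?_⟩
  have := hB (x / r) (by positivity)
  have hrc : (r : ℂ) ≠ 0 := by exact_mod_cast hr.ne'
  rw [huv, show ((x / r : ℝ) : ℂ) * (r * v) = x * v by push_cast; field_simp] at this
  simpa using this

/-- An entire function of exponential type that decays faster than every exponential along a ray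
vanishes identically. -/
theorem IsExponentialType.eq_zero_of_decaysAlong {f : ℂ → ℂ} (hd : Differentiable ℂ f)
    (hf : IsExponentialType f) (h : DecaysAlong f 1) (z : ℂ) : f z = 0 := by
  -- Two turns by an eighth make a quarter turn, so the decay reaches all four half-axes.
  have hI : (1 + I) * (1 + I) = 2 * I := by ring_nf; simp
  have step : ∀ {u : ℂ}, DecaysAlong f u → DecaysAlong f (u * (2 * I)) := fun hu => by
    have := (hu.mul_one_add_I hd hf).mul_one_add_I hd hf
    rwa [mul_assoc, hI] at this
  have d1 := step h
  have d2 := step d1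
  have d3 := step d2
  obtain ⟨B₀, h₀⟩ := h.exists_bound (r := 1) (v := 1) one_pos (by simp)
  obtain ⟨B₁, h₁⟩ := d1.exists_bound (r := 2) (v := I) two_pos (by push_cast; ring)
  obtain ⟨B₂, h₂⟩ := d2.exists_bound (r := 4) (v := -1) four_pos
    (by push_cast; linear_combination 4 * I_sq)
  obtain ⟨B₃, h₃⟩ := d3.exists_bound (r := 8) (v := -I) (by norm_num)
    (by push_cast; linear_combination 8 * I * I_sq)
  set B := max (max B₀ B₁) (max B₂ B₃) with hB
  have k₀ : ∀ x : ℝ, 0 ≤ x → ‖f (x * 1)‖ ≤ B := fun x hx => (h₀ x hx).trans (by simp [hB])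
  have k₁ : ∀ x : ℝ, 0 ≤ x → ‖f (x * I)‖ ≤ B := fun x hx => (h₁ x hx).trans (by simp [hB])
  have k₂ : ∀ x : ℝ, 0 ≤ x → ‖f (x * -1)‖ ≤ B := fun x hx => (h₂ x hx).trans (by simp [hB])
  have k₃ : ∀ x : ℝ, 0 ≤ x → ‖f (x * -I)‖ ≤ B := fun x hx => (h₃ x hx).trans (by simp [hB])
  -- Boundedness on the sides of each quadrant extends to its interior; Liouville's theorem then
  -- makes `f` constant, and decay along the ray makes the constant zero.
  have quad : ∀ u : ℂ, (∀ x : ℝ, 0 ≤ x → ‖f (x * u)‖ ≤ B) →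
      (∀ x : ℝ, 0 ≤ x → ‖f (x * (I * u))‖ ≤ B) →
      ∀ w : ℂ, 0 ≤ w.re → 0 ≤ w.im → ‖f (u * w)‖ ≤ B := by
    intro u hu hIu w hre him
    obtain ⟨C, α, hb⟩ := hf.comp_const_mul u
    refine PhragmenLindelof.quadrant_I (f := fun z => f (u * z))
      (hd.comp (by fun_prop)).diffContOnCl (isBigO_exp_of_norm_le hb _)
      (fun x hx => ?_) (fun x hx => ?_) hre him
    · simpa [mul_comm] using hu x hx
    · rw [show u * (x * I) = x * (I * u) by ring]
      exact hIu x hx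
  have bound : ∀ w, ‖f w‖ ≤ B := by
    intro w
    rcases le_total 0 w.re with hr | hr <;> rcases le_total 0 w.im with hi | hi
    · simpa using quad 1 k₀ (by simpa using k₁) w hr hi
    · have := quad (-I) k₃ (by simpa using k₀) (I * w) (by simpa using hi) (by simpa using hr)
      rwa [show -I * (I * w) = w by linear_combination (-w) * I_sq] at this
    · have := quad I k₁ (by simpa using k₂) (-I * w) (by simpa using hi) (by simpa using hr)
      rwa [show I * (-I * w) = w by linear_combination (-w) * I_sq] at this
    · have := quad (-1) k₂ (by simpa using k₃) (-w) (by simpa using hr) (by simpa using hi)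
      simpa using this
  have hconst : ∀ w, f w = f 0 := fun w =>
    hd.apply_eq_apply_of_bounded
      (isBounded_iff_forall_norm_le.2 ⟨B, by rintro _ ⟨w, rfl⟩; exact bound w⟩) w 0
  obtain ⟨D, hD⟩ := h 1
  have hlim : Tendsto (fun x : ℝ => D * Real.exp (-(1 * x))) atTop (nhds (D * 0)) := by
    refine Tendsto.const_mul D ?_
    simp only [one_mul]
    exact Real.tendsto_exp_neg_atTop_nhds_zero
  have h0 : ‖f 0‖ ≤ D * 0 := ge_of_tendsto hlim ((eventually_ge_atTop 0).mono fun x hx => by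
    rw [← hconst (x * 1)]
    exact hD x hx)
  rw [hconst z]
  simpa using h0

/-- With `log 0 = ⊥` in `EReal` the zeros of the function need no separate treatment. -/
theorem log_enorm_div_le_iff {w : ℂ} {y c : ℝ} (hy : 0 < y) :
    ENNReal.log ‖w‖ₑ / (y : EReal) ≤ (c : EReal) ↔ ‖w‖ ≤ Real.exp (c * y) := by
  rw [EReal.div_le_iff_le_mul (by exact_mod_cast hy) (EReal.coe_ne_top _), ← EReal.coe_mul,
    ← EReal.log_exp ((y * c : ℝ) : EReal), ENNReal.log_le_log_iff, EReal.exp_coe,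
    ← ofReal_norm, ENNReal.ofReal_le_ofReal_iff (Real.exp_pos _).le, mul_comm]

theorem limsup_log_enorm_div_le {g : ℝ → ℂ} {A C : ℝ} (hC : 0 < C)
    (h : ∀ y : ℝ, 0 ≤ y → ‖g y‖ ≤ C * Real.exp (A * y + C * √y)) :
    limsup (fun y : ℝ => ENNReal.log ‖g y‖ₑ / (y : EReal)) atTop ≤ (A : EReal) := by
  refine EReal.le_of_forall_lt_iff_le.1 fun A' hA' => ?_
  have hA : 0 < A' - A := sub_pos.2 (by exact_mod_cast hA')
  refine limsup_le_of_le (by isBoundedDefault) ?_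
  -- The first threshold absorbs the constant through `C ≤ e^C ≤ e^{C√y}`, the second gives `2C√y ≤
  -- (A' - A) y`.
  filter_upwards [eventually_ge_atTop 1, eventually_ge_atTop ((2 * C / (A' - A)) ^ 2)] with y h1 h2
  have hy : 0 < y := by linarith
  rw [log_enorm_div_le_iff hy]
  refine (h y hy.le).trans ?_
  have hCe : C ≤ Real.exp C := by linarith [Real.add_one_le_exp C]
  refine (mul_le_mul_of_nonneg_right hCe (Real.exp_pos _).le).trans ?_
  rw [← Real.exp_add]
  refine Real.exp_le_exp.2 ?_
  have hs1 : 1 ≤ √y := Real.one_le_sqrt.2 h1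
  have hs2 : 2 * C / (A' - A) ≤ √y := Real.le_sqrt_of_sq_le h2
  have hs3 : 2 * C ≤ √y * (A' - A) := (div_le_iff₀ hA).1 hs2
  have hss : √y * √y = y := Real.mul_self_sqrt hy.le
  have hs4 : 2 * C * √y ≤ (A' - A) * y := by
    have := mul_le_mul_of_nonneg_right hs3 (Real.sqrt_nonneg y)
    calc _ ≤ √y * (A' - A) * √y := this
      _ = (A' - A) * (√y * √y) := by ring
      _ = _ := by rw [hss]
  have hs5 : C * 1 ≤ C * √y := mul_le_mul_of_nonneg_left hs1 hC.le
  linarith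

theorem decaysAlong_of_limsup_eq_bot {f : ℂ → ℂ} (hf : Continuous f)
    (h : limsup (fun y : ℝ => ENNReal.log ‖f y‖ₑ / (y : EReal)) atTop = ⊥) : DecaysAlong f 1 := by
  intro N
  have hlt : limsup (fun y : ℝ => ENNReal.log ‖f y‖ₑ / (y : EReal)) atTop < ((-N : ℝ) : EReal) := by
    rw [h]; exact EReal.bot_lt_coe _
  obtain ⟨Y, hY⟩ := eventually_atTop.1 (eventually_lt_of_limsup_lt hlt)
  have hc : Continuous fun x : ℝ => f x * exp (N * x) := by fun_prop
  obtain ⟨B, hB⟩ := (isCompact_Icc (a := (0 : ℝ)) (b := max Y 1)).exists_bound_of_continuousOn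
    hc.continuousOn
  refine ⟨max B 1, fun x hx => ?_⟩
  rw [mul_one]
  rcases le_total x (max Y 1) with hx' | hx'
  · have := hB x ⟨hx, hx'⟩
    rw [norm_mul, norm_exp, show ((N : ℂ) * x).re = N * x by simp] at this
    calc ‖f x‖ = ‖f x‖ * Real.exp (N * x) * Real.exp (-(N * x)) := by
          rw [mul_assoc, ← Real.exp_add]; simp
      _ ≤ _ := mul_le_mul_of_nonneg_right (this.trans (le_max_left _ _)) (Real.exp_pos _).le
  · have hpos : 0 < x := lt_of_lt_of_le one_pos ((le_max_right _ _).trans hx')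
    have := (log_enorm_div_le_iff hpos).1 (hY x ((le_max_left _ _).trans hx')).le
    rw [neg_mul] at this
    exact this.trans (le_mul_of_one_le_left (Real.exp_pos _).le (le_max_right _ _))

/-- The index of a nonzero entire function of exponential type along a ray is finite. -/
theorem exists_limsup_eq_coe {f : ℂ → ℂ} (hd : Differentiable ℂ f) (hf : IsExponentialType f)
    (h0 : f 0 ≠ 0) {A C : ℝ} (hC : 0 < C)
    (h : ∀ y : ℝ, 0 ≤ y → ‖f y‖ ≤ C * Real.exp (A * y + C * √y)) :
    ∃ B : ℝ, limsup (fun y : ℝ => ENNReal.log ‖f y‖ₑ / (y : EReal)) atTop = (B : EReal) ∧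
      B ≤ A := by
  have hle := limsup_log_enorm_div_le hC h
  generalize hL : limsup (fun y : ℝ => ENNReal.log ‖f y‖ₑ / (y : EReal)) atTop = L at hle
  induction L with
  | bot => exact absurd (hf.eq_zero_of_decaysAlong hd 
      (decaysAlong_of_limsup_eq_bot hd.continuous hL) 0) h0
  | coe B => exact ⟨B, rfl, by exact_mod_cast hle⟩
  | top => exact absurd hle (by simp)

/-- The numerator is `O((1 + x²)^{1/4})`, so the integrand is `O((1 + x²)^{-3/4})`, which decays
like `|x|^{-3/2}`. -/
theorem integrable_posLog_div {g : ℝ → ℂ} (hg : Continuous g) {C : ℝ} (hC : 0 < C)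
    (h : ∀ x : ℝ, ‖g x‖ ≤ C * Real.exp (C * √|x|)) :
    Integrable (fun x : ℝ => Real.posLog ‖g x‖ / (1 + x ^ 2)) := by
  have hi := (integrable_rpow_neg_one_add_norm_sq (E := ℝ) (μ := volume) (r := 3 / 2)
    (by norm_num)).const_mul (2 * C)
  refine hi.mono' ?_ (Eventually.of_forall fun x => ?_)
  · have hc : Continuous fun x : ℝ => Real.posLog ‖g x‖ / (1 + x ^ 2) :=
      (Real.continuous_posLog.comp hg.norm).div₀ (by fun_prop) fun x => by positivity
    exact hc.aestronglyMeasurable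
  · have hp : 0 < 1 + x ^ 2 := by positivity
    have h1 : Real.posLog ‖g x‖ ≤ C + C * √|x| := by
      have hb : ‖g x‖ ≤ Real.exp (C + C * √|x|) := (h x).trans (by
        rw [Real.exp_add]
        exact mul_le_mul_of_nonneg_right (by linarith [Real.add_one_le_exp C])
          (Real.exp_pos _).le)
      refine max_le (by positivity) ?_
      rcases (norm_nonneg (g x)).eq_or_lt with h0 | h0
      · rw [← h0, Real.log_zero]; positivity
      · exact (Real.log_le_iff_le_exp h0).2 hb
    have hq : (1 + x ^ 2) ^ (-(3 / 2) / 2 : ℝ) * (1 + x ^ 2) = (1 + x ^ 2) ^ (1 / 4 : ℝ) := by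
      rw [← Real.rpow_add_one hp.ne']
      norm_num
    have h2 : (1 : ℝ) ≤ (1 + x ^ 2) ^ (1 / 4 : ℝ) :=
      Real.one_le_rpow (by nlinarith [sq_nonneg x]) (by norm_num)
    have h3 : √|x| ≤ (1 + x ^ 2) ^ (1 / 4 : ℝ) := by
      have : √|x| = (x ^ 2) ^ (1 / 4 : ℝ) := by
        rw [Real.sqrt_eq_rpow, ← sq_abs, ← Real.rpow_natCast, ← Real.rpow_mul (abs_nonneg x)]
        norm_num
      rw [this]
      exact Real.rpow_le_rpow (sq_nonneg x) (by linarith) (by norm_num)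
    rw [Real.norm_of_nonneg (div_nonneg Real.posLog_nonneg hp.le), div_le_iff₀ hp, Real.norm_eq_abs,
      sq_abs]
    rw [mul_assoc, hq]
    nlinarith

end ExponentialType

end

/-! ### Assembly in the variable `z = iξ` -/

theorem mainTheorem2 (M : ElasticMedium) (ω : ℝ) (hω : 0 < ω) :
    ∃ A B : ℝ,
      IsCartwright (fun z : ℂ => M.rayleighF ω (-(Complex.I * z))) A B ∧
        A ≤ 8 * M.H ∧ B ≤ 8 * M.H := by
  have hd := M.differentiable_rayleighF ω
  have h0 := ElasticMedium.rayleighF_zero_ne_zero (M := M) hω.ne'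
  obtain ⟨C, hC, hb⟩ := M.exists_norm_rayleighF_le ω
  have hH := M.H_pos
  have hexp : IsExponentialType (M.rayleighF ω) := by
    refine ⟨C * Real.exp C, 8 * M.H + C, fun z => (hb z).trans ?_⟩
    rw [mul_assoc C, ← Real.exp_add]
    refine mul_le_mul_of_nonneg_left (Real.exp_le_exp.2 ?_) hC.le
    have h1 : √‖z‖ ≤ 1 + ‖z‖ := by
      rw [Real.sqrt_le_left (by positivity)]
      nlinarith [norm_nonneg z]
    have h2 := mul_le_mul_of_nonneg_left (abs_re_le_norm z) (by positivity : 0 ≤ 8 * M.H)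
    have h3 := mul_le_mul_of_nonneg_left h1 hC.le
    linarith
  obtain ⟨A, hA, hA8⟩ := exists_limsup_eq_coe hd hexp h0 (A := 8 * M.H) hC fun y hy => by
    simpa [abs_of_nonneg hy] using hb y
  obtain ⟨B, hB, hB8⟩ := exists_limsup_eq_coe (f := fun z => M.rayleighF ω (-1 * z))
    (hd.comp (by fun_prop)) (hexp.comp_const_mul (-1)) (by simpa using h0) (A := 8 * M.H) hC
    fun y hy => by simpa [abs_of_nonneg hy] using hb (-y)
  -- The upper and lower imaginary half-axes in `z` are the positive and negative real half-axes in
  -- `ξ`.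
  have e1 : ∀ y : ℂ, -(I * (I * y)) = y := fun y => by linear_combination (-y) * I_sq
  have e2 : ∀ y : ℂ, -(I * -(I * y)) = -1 * y := fun y => by linear_combination y * I_sq
  refine ⟨A, B, ⟨hd.comp (by fun_prop), ?_, ?_, ?_, ?_⟩, hA8, hB8⟩
  · simpa [neg_mul] using hexp.comp_const_mul (-I)
  · refine integrable_posLog_div (g := fun x : ℝ => M.rayleighF ω (-(I * x)))
      (hd.continuous.comp (by fun_prop)) hC fun x => ?_
    simpa using hb (-(I * x))
  · simpa only [upperIndex, e1] using hA
  · simpa only [lowerIndex, e2] using hB
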